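/- Let $Y$ be a complex Hilbert space, let $M$ be a (possibly unbounded) positive selfadjoint operator in $Y$ and let $C$ be a bounded operator on $Y$ which is sectorial, i.e. its numerical range $\{(Cy,y):y\in Y\}$ lies in a sector $\{\zeta\in\mathbb C:|\arg\zeta|\le\theta\}$ with some $\theta<\pi/2$ (where $\arg 0=0$). In the Hilbert space $Y\oplus Y$ consider $$\mathcal A^+=\begin{pmatrix}-C&-M^{1/2}\\ M^{1/2}&0\end{pmatrix},\qquad \mathcal D(\mathcal A^+)=\mathcal D(M^{1/2})\oplus\mathcal D(M^{1/2}),$$ let $\mathcal X=\mathcal N(\mathcal A^+)^\perp$ be the orthogonal complement of its null-space, and let $\mathcal A$ be the operator in $\mathcal X$ which is the inverse of the (injective) part of $\mathcal A^+$ in $\mathcal X$. The second order system $M\ddot y+C\dot y+y=0$ is called exponentially stable if the semigroup generated by $\mathcal A$ in $\mathcal X$ is exponentially stable, i.e. if $\mathcal A$ generates a strongly continuous semigroup with $\|e^{\mathcal At}\|\le ce^{-\beta t}$, $t\ge0$, for some $c,\beta>0$. Then $M\ddot y+C\dot y+y=0$ is exponentially stable if and only if the purely damped system $$M\ddot y+\hat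 C\dot y+y=0,\qquad \hat C=\frac{C^*+C}{2},$$ is exponentially stable (with the operator, the space and the semigroup constructed in the same way from $M$ and $\hat C$). -/

import Mathlib

open scoped NNReal Topology InnerProductSpace

noncomputable section

namespace DampedSystem

section Operators

variable {H : Type*} [NormedAddCommGroup H] [InnerProductSpace ℂ H]

/-- A (possibly unbounded) operator is positive selfadjoint: `T = T†` (so `T` is densely defined)
and `(T x, x) ≥ 0` on its domain. -/
structure IsPosSelfAdjoint [CompleteSpace H] (T : H →ₗ.[ℂ] H) : Prop where
  isSelfAdjoint : IsSelfAdjoint T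
  re_inner_nonneg : ∀ x : T.domain, 0 ≤ (⟪(x : H), T x⟫_ℂ).re

/-- `S` is the positive square root of `T`: `S` is positive selfadjoint and `T = S ∘ S`, where
`S ∘ S` has its maximal domain, the set of all `x ∈ D(S)` with `S x ∈ D(S)`. -/
structure IsPosSqrt [CompleteSpace H] (S T : H →ₗ.[ℂ] H) : Prop where
  isPosSelfAdjoint : IsPosSelfAdjoint S
  mem_graph_iff : ∀ x y : H, (x, y) ∈ T.graph ↔ ∃ z, (x, z) ∈ S.graph ∧ (z, y) ∈ S.graph

section SqrtExists

variable [CompleteSpace H]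

theorem inner_graph_symm {T : H →ₗ.[ℂ] H} (hT : IsPosSelfAdjoint T) {x y x' y' : H}
    (h : (x, y) ∈ T.graph) (h' : (x', y') ∈ T.graph) : ⟪y, x'⟫_ℂ = ⟪x, y'⟫_ℂ := by
  rw [LinearPMap.mem_graph_iff] at h h'
  obtain ⟨u, rfl, rfl⟩ := h
  obtain ⟨v, rfl, rfl⟩ := h'
  have key := LinearPMap.adjoint_isFormalAdjoint (T := T) hT.isSelfAdjoint.dense_domain
  rw [(LinearPMap.isSelfAdjoint_def).mp hT.isSelfAdjoint] at key
  exact key u v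

theorem inner_graph_nonneg {T : H →ₗ.[ℂ] H} (hT : IsPosSelfAdjoint T) {x y : H}
    (h : (x, y) ∈ T.graph) : 0 ≤ (⟪x, y⟫_ℂ).re := by
  rw [LinearPMap.mem_graph_iff] at h
  obtain ⟨u, rfl, rfl⟩ := h
  exact hT.re_inner_nonneg u

theorem mem_graph_of_adjoint {T : H →ₗ.[ℂ] H} (hT : IsSelfAdjoint T) {w z : H}
    (h : ∀ x : T.domain, ⟪z, (x : H)⟫_ℂ = ⟪w, T x⟫_ℂ) : (w, z) ∈ T.graph := by
  have hw := LinearPMap.mem_adjoint_domain_of_exists (T := T) w ⟨z, h⟩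
  have hz := LinearPMap.adjoint_apply_eq (T := T) hT.dense_domain ⟨w, hw⟩ h
  have := LinearPMap.mem_graph (LinearPMap.adjoint T) ⟨w, hw⟩
  rw [hz] at this
  have hgr : (LinearPMap.adjoint T).graph = T.graph :=
    congrArg LinearPMap.graph ((LinearPMap.isSelfAdjoint_def).mp hT)
  exact hgr ▸ this

theorem norm_add_sq_ge {T : H →ₗ.[ℂ] H} (hT : IsPosSelfAdjoint T) {x y : H}
    (h : (x, y) ∈ T.graph) : ‖x‖ ^ 2 + ‖y‖ ^ 2 ≤ ‖x + y‖ ^ 2 := by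
  have h1 := inner_graph_nonneg hT h
  have h2 := norm_add_sq (𝕜 := ℂ) x y
  have h3 : (RCLike.re ⟪x, y⟫_ℂ : ℝ) = (⟪x, y⟫_ℂ).re := rfl
  rw [h3] at h2
  linarith

/-- `(1 + T)⁻¹` as an everywhere defined operator. -/
theorem exists_resolvent {T : H →ₗ.[ℂ] H} (hT : IsPosSelfAdjoint T) :
    ∃ R : H →L[ℂ] H, (∀ h, (R h, h - R h) ∈ T.graph) ∧
      ∀ x y, (x, y) ∈ T.graph → R (x + y) = x := by
  let g : T.graph →L[ℂ] H :=
    (ContinuousLinearMap.fst ℂ H H + ContinuousLinearMap.snd ℂ H H).comp T.graph.subtypeL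
  have hg : ∀ p : T.graph, g p = p.1.1 + p.1.2 := fun p => rfl
  have hle : ∀ p : T.graph, ‖p‖ ≤ ‖g p‖ := by
    intro p
    have h := norm_add_sq_ge hT (x := p.1.1) (y := p.1.2) p.2
    rw [hg, Submodule.coe_norm, Prod.norm_def]
    refine max_le ?_ ?_ <;> refine abs_le_of_sq_le_sq' ?_ (norm_nonneg _) |>.2 <;>
      nlinarith [sq_nonneg ‖p.1.1‖, sq_nonneg ‖p.1.2‖]
  have hanti : AntilipschitzWith 1 g :=
    AddMonoidHomClass.antilipschitz_of_bound g (by simpa using hle)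
  have hclosed : IsClosed (T.graph : Set (H × H)) := hT.isSelfAdjoint.isClosed
  have : CompleteSpace T.graph := hclosed.completeSpace_coe
  have hrc : IsClosed (Set.range g) := hanti.isClosed_range g.uniformContinuous
  have hsurj : Function.Surjective g := by
    change Function.Surjective (g : T.graph →ₗ[ℂ] H)
    rw [← LinearMap.range_eq_top (f := (g : T.graph →ₗ[ℂ] H))]
    set K := LinearMap.range (g : T.graph →ₗ[ℂ] H) with hK
    have hKc : IsClosed (K : Set H) := by
      simpa [hK, LinearMap.coe_range] using hrc
    have : CompleteSpace K := hKc.completeSpace_coe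
    rw [← Submodule.orthogonal_eq_bot_iff, Submodule.eq_bot_iff]
    intro w hw
    have hmem : (w, -w) ∈ T.graph := by
      refine mem_graph_of_adjoint hT.isSelfAdjoint fun x => ?_
      have := (Submodule.mem_orthogonal' K w).1 hw ((x : H) + T x)
        ⟨⟨((x : H), T x), T.mem_graph x⟩, rfl⟩
      rw [inner_add_right] at this
      rw [inner_neg_left]
      exact neg_eq_of_add_eq_zero_right this
    have := norm_add_sq_ge hT hmem
    simp only [add_neg_cancel, norm_zero, norm_neg] at this
    have h0 : ‖w‖ = 0 := by nlinarith [norm_nonneg w]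
    simpa using h0
  let e : T.graph ≃ₗ[ℂ] H :=
    LinearEquiv.ofBijective (g : T.graph →ₗ[ℂ] H) ⟨hanti.injective, hsurj⟩
  have he : ∀ h, (e.symm h).1.1 + (e.symm h).1.2 = h := fun h => e.apply_symm_apply h
  let R : H →L[ℂ] H :=
    ((LinearMap.fst ℂ H H).comp (T.graph.subtype.comp (e.symm : H →ₗ[ℂ] T.graph))).mkContinuous 1
      (by
        intro h
        have h1 := hle (e.symm h)
        rw [hg, he, Submodule.coe_norm, Prod.norm_def] at h1
        rw [one_mul]
        exact (le_max_left _ _).trans h1)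
  have hR : ∀ h, R h = (e.symm h).1.1 := fun h => rfl
  refine ⟨R, fun h => ?_, fun x y hxy => ?_⟩
  · have : h - R h = (e.symm h).1.2 := by rw [hR, sub_eq_iff_eq_add', he]
    rw [this, hR]
    exact (e.symm h).2
  · have : e.symm (x + y) = ⟨(x, y), hxy⟩ := by
      rw [LinearEquiv.symm_apply_eq]; rfl
    rw [hR, this]

/-- Every positive selfadjoint operator has a positive square root. -/
theorem exists_isPosSqrt {T : H →ₗ.[ℂ] H} (hT : IsPosSelfAdjoint T) : ∃ S, IsPosSqrt S T := by
  obtain ⟨R, hR1, hR2⟩ := exists_resolvent hT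
  have hsymR : ∀ h k, ⟪R h, k⟫_ℂ = ⟪h, R k⟫_ℂ := by
    intro h k
    have := inner_graph_symm hT (hR1 h) (hR1 k)
    rw [inner_sub_left, inner_sub_right] at this
    exact (sub_left_injective this).symm
  have hR0 : 0 ≤ R := by
    rw [ContinuousLinearMap.nonneg_iff_isPositive, ContinuousLinearMap.isPositive_def]
    refine ⟨fun h k => hsymR h k, fun h => ?_⟩
    have h1 := inner_graph_nonneg hT (hR1 h)
    rw [inner_sub_right, inner_self_eq_norm_sq_to_K, Complex.sub_re] at h1
    have h2 : ((‖R h‖ : ℂ) ^ 2).re = ‖R h‖ ^ 2 := by norm_cast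
    rw [ContinuousLinearMap.reApplyInnerSelf_apply]
    change 0 ≤ (⟪R h, h⟫_ℂ).re
    have h3 : (0 : ℝ) ≤ ‖R h‖ ^ 2 := sq_nonneg _
    have h4 : ((RCLike.ofReal ‖R h‖ : ℂ) ^ 2).re = ‖R h‖ ^ 2 := h2
    linarith
  have hR1' : 0 ≤ 1 - R := by
    rw [ContinuousLinearMap.nonneg_iff_isPositive, ContinuousLinearMap.isPositive_def]
    refine ⟨fun h k => ?_, fun h => ?_⟩
    · change ⟪h - R h, k⟫_ℂ = ⟪h, k - R k⟫_ℂ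
      rw [inner_sub_left, inner_sub_right, hsymR]
    · rw [ContinuousLinearMap.reApplyInnerSelf_apply]
      change 0 ≤ (⟪h - R h, h⟫_ℂ).re
      have h1 := inner_graph_nonneg hT (hR1 h)
      have h2 : ⟪h - R h, h⟫_ℂ = ⟪h - R h, h - R h⟫_ℂ + ⟪h - R h, R h⟫_ℂ := by
        rw [← inner_add_right, sub_add_cancel]
      have h3 : 0 ≤ (⟪h - R h, h - R h⟫_ℂ).re := inner_self_nonneg (𝕜 := ℂ)
      have h4 := inner_graph_symm hT (hR1 h) (hR1 h)
      rw [h2, Complex.add_re, h4]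
      linarith
  set B : H →L[ℂ] H := CFC.sqrt R with hB
  set D : H →L[ℂ] H := CFC.sqrt (1 - R) with hD
  have hBB : B * B = R := CFC.sqrt_mul_sqrt_self R hR0
  have hDD : D * D = 1 - R := CFC.sqrt_mul_sqrt_self (1 - R) hR1'
  have hcomm : Commute B D := by
    have h1 : Commute R (1 - R) := (Commute.one_right R).sub_right (Commute.refl R)
    have h2 : Commute B (1 - R) := h1.cfcₙ_nnreal _
    exact (h2.symm.cfcₙ_nnreal _).symm
  have hBp : 0 ≤ B := CFC.sqrt_nonneg R
  have hDp : 0 ≤ D := CFC.sqrt_nonneg (1 - R)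
  have hBs : ∀ h k, ⟪B h, k⟫_ℂ = ⟪h, B k⟫_ℂ :=
    ((ContinuousLinearMap.nonneg_iff_isPositive B).1 hBp).inner_left_eq_inner_right
  have hDs : ∀ h k, ⟪D h, k⟫_ℂ = ⟪h, D k⟫_ℂ :=
    ((ContinuousLinearMap.nonneg_iff_isPositive D).1 hDp).inner_left_eq_inner_right
  have bb : ∀ h, B (B h) = R h := fun h => DFunLike.congr_fun hBB h
  have dd : ∀ h, D (D h) = h - R h := fun h => DFunLike.congr_fun hDD h
  have bd : ∀ h, B (D h) = D (B h) := fun h => DFunLike.congr_fun hcomm.eq h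
  have hBinj : ∀ u, B u = 0 → u = 0 := by
    intro u hu
    have h1 : R u = 0 := by rw [← bb, hu, map_zero]
    have h2 := hR1 u
    rw [h1, sub_zero] at h2
    exact LinearPMap.graph_fst_eq_zero_snd T h2 rfl
  let G : Submodule ℂ (H × H) := LinearMap.range ((B : H →ₗ[ℂ] H).prod (D : H →ₗ[ℂ] H))
  have hG : ∀ x y, (x, y) ∈ G ↔ ∃ u, B u = x ∧ D u = y := by
    intro x y
    simp [G, LinearMap.mem_range, Prod.ext_iff]
  have hG0 : ∀ p ∈ G, p.1 = 0 → p.2 = 0 := by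
    rintro ⟨x, y⟩ hp (rfl : x = 0)
    obtain ⟨u, hu, rfl⟩ := (hG _ _).1 hp
    simp [hBinj u hu]
  let S : H →ₗ.[ℂ] H := G.toLinearPMap
  have hSG : S.graph = G := Submodule.toLinearPMap_graph_eq G hG0
  have hS : ∀ x y, (x, y) ∈ S.graph ↔ ∃ u, B u = x ∧ D u = y := by
    intro x y; rw [hSG, hG]
  have hpt : ∀ x : S.domain, ∃ u, B u = (x : H) ∧ D u = S x := fun x =>
    (hS _ _).1 (S.mem_graph x)
  have hdense : Dense (S.domain : Set H) := by
    rw [Submodule.dense_iff_topologicalClosure_eq_top, Submodule.topologicalClosure_eq_top_iff,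
      Submodule.eq_bot_iff]
    intro w hw
    apply hBinj
    have hBw : B (B w) ∈ S.domain :=
      (LinearPMap.mem_domain_iff).2 ⟨D (B w), (hS _ _).2 ⟨B w, rfl, rfl⟩⟩
    have := (Submodule.mem_orthogonal' _ w).1 hw _ hBw
    rw [← hBs, inner_self_eq_zero] at this
    exact this
  refine ⟨S, ⟨?_, fun x => ?_⟩, fun x y => ⟨?_, ?_⟩⟩
  · rw [LinearPMap.isSelfAdjoint_def]
    refine le_antisymm (And.intro ?_ ?_) (LinearPMap.IsFormalAdjoint.le_adjoint hdense ?_)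
    · intro x hx
      have hadj := LinearPMap.adjoint_isFormalAdjoint hdense ⟨x, hx⟩
      obtain ⟨u, hu⟩ : ∃ u, B u = x := by
        refine ⟨B x + D (LinearPMap.adjoint S ⟨x, hx⟩), ?_⟩
        have hkey : B (LinearPMap.adjoint S ⟨x, hx⟩) = D x := by
          refine ext_inner_right ℂ fun u => ?_
          obtain ⟨v, hv⟩ : ∃ v : S.domain, B u = v ∧ D u = S v :=
            (LinearPMap.mem_graph_iff' S).1 ((hS _ _).2 ⟨u, rfl, rfl⟩) |>.imp fun v hv => by
              rw [Prod.ext_iff] at hv; exact ⟨hv.1.symm, hv.2.symm⟩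
          rw [hBs, hDs, hv.1, hv.2]
          exact hadj v
        rw [map_add, bb, bd, hkey, dd]; abel
      exact (LinearPMap.mem_domain_iff).2 ⟨D u, (hS _ _).2 ⟨u, hu, rfl⟩⟩
    · rintro ⟨x, hx⟩ ⟨y, hy⟩ (rfl : x = y)
      refine LinearPMap.adjoint_apply_eq hdense ⟨x, hx⟩ fun v => ?_
      obtain ⟨u, hu, hu'⟩ := hpt ⟨x, hy⟩
      obtain ⟨v', hv, hv'⟩ := hpt v
      rw [← hu', ← hv', ← hv]
      change ⟪D u, B v'⟫_ℂ = ⟪x, D v'⟫_ℂ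
      rw [← show B u = x from hu, hDs, hBs, bd]
    · intro v w
      obtain ⟨u, hu, hu'⟩ := hpt v
      obtain ⟨v', hv, hv'⟩ := hpt w
      rw [← hu', ← hv', ← hv, ← hu, hDs, hBs, bd]
  · obtain ⟨u, hu, hu'⟩ := hpt x
    rw [← hu, ← hu']
    set E : H →L[ℂ] H := CFC.sqrt B with hE
    have hEE : E * E = B := CFC.sqrt_mul_sqrt_self B hBp
    have hEs : ∀ h k, ⟪E h, k⟫_ℂ = ⟪h, E k⟫_ℂ :=
      ((ContinuousLinearMap.nonneg_iff_isPositive E).1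
        (CFC.sqrt_nonneg B)).inner_left_eq_inner_right
    have hED : Commute E D := hcomm.cfcₙ_nnreal _
    have ed : E (D u) = D (E u) := DFunLike.congr_fun hED.eq u
    have ee : E (E u) = B u := DFunLike.congr_fun hEE u
    rw [← ee, hEs, ed]
    exact ((ContinuousLinearMap.nonneg_iff_isPositive D).1 hDp).re_inner_nonneg_right (E u)
  · intro hxy
    have hx : R (x + y) = x := hR2 x y hxy
    have hy : D (D (x + y)) = y := by rw [dd, hx]; abel
    refine ⟨D (B (x + y)), (hS _ _).2 ⟨B (x + y), ?_, rfl⟩, (hS _ _).2 ⟨D (x + y), bd _, hy⟩⟩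
    rw [bb, hx]
  · rintro ⟨z, hz, hz'⟩
    obtain ⟨u, hu, hu'⟩ := (hS _ _).1 hz
    obtain ⟨v, hv, hv'⟩ := (hS _ _).1 hz'
    have h1 : R (x + y) = x := by
      rw [← bb, ← hu, ← hv', map_add, bd, hv, ← hu', bb, dd, add_sub_cancel]
    have h2 := hR1 (x + y)
    rwa [h1, add_sub_cancel_left] at h2

end SqrtExists

/-- The positive square root `T^{1/2}` of a positive selfadjoint operator. -/
def posSqrt [CompleteSpace H] (T : H →ₗ.[ℂ] H) (hT : IsPosSelfAdjoint T) : H →ₗ.[ℂ] H :=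
  (exists_isPosSqrt hT).choose

theorem posSqrt_spec [CompleteSpace H] (T : H →ₗ.[ℂ] H) (hT : IsPosSelfAdjoint T) :
    IsPosSqrt (posSqrt T hT) T :=
  (exists_isPosSqrt hT).choose_spec

/-- The null-space of a partially defined operator, as a subspace of the whole space. -/
def nullSpace (T : H →ₗ.[ℂ] H) : Submodule ℂ H :=
  (LinearMap.ker T.toFun).map T.domain.subtype

/-- The part of `T` in a subspace `X`: the operator `x ↦ T x` in `X` with domain
`{x ∈ X ∩ D(T) : T x ∈ X}`. -/
def partIn (T : H →ₗ.[ℂ] H) (X : Submodule ℂ H) : X →ₗ.[ℂ] X where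
  domain :=
    { carrier := {x | ∃ h : (x : H) ∈ T.domain, T ⟨x, h⟩ ∈ X}
      zero_mem' := ⟨T.domain.zero_mem, by
        have : T ⟨((0 : X) : H), T.domain.zero_mem⟩ = 0 := T.map_zero
        rw [this]; exact X.zero_mem⟩
      add_mem' := by
        rintro x y ⟨hx, hx'⟩ ⟨hy, hy'⟩
        refine ⟨T.domain.add_mem hx hy, ?_⟩
        have : T ⟨((x + y : X) : H), T.domain.add_mem hx hy⟩ = T ⟨x, hx⟩ + T ⟨y, hy⟩ :=
          T.map_add ⟨x, hx⟩ ⟨y, hy⟩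
        rw [this]; exact X.add_mem hx' hy'
      smul_mem' := by
        rintro c x ⟨hx, hx'⟩
        refine ⟨T.domain.smul_mem c hx, ?_⟩
        have : T ⟨((c • x : X) : H), T.domain.smul_mem c hx⟩ = c • T ⟨x, hx⟩ :=
          T.map_smul c ⟨x, hx⟩
        rw [this]; exact X.smul_mem c hx' }
  toFun :=
    { toFun := fun x => ⟨T ⟨(x : X), x.2.1⟩, x.2.2⟩
      map_add' := fun x y =>
        Subtype.ext (T.map_add ⟨((x : X) : H), x.2.1⟩ ⟨((y : X) : H), y.2.1⟩)
      map_smul' := fun c x => Subtype.ext (T.map_smul c ⟨((x : X) : H), x.2.1⟩) }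

end Operators

section Semigroups

variable {X : Type*} [NormedAddCommGroup X] [NormedSpace ℂ X]

/-- Strongly continuous (one-parameter) semigroups of bounded operators. -/
structure IsC0Semigroup (T : ℝ≥0 → X →L[ℂ] X) : Prop where
  map_zero : T 0 = 1
  map_add : ∀ s t, T (s + t) = T s * T t
  continuous : ∀ x, Continuous fun t => T t x

/-- `A` is the generator of `T`: its graph consists of all `(x, y)` such that
`(T t x - x) / t → y` as `t ↓ 0`. -/
def IsGenerator (A : X →ₗ.[ℂ] X) (T : ℝ≥0 → X →L[ℂ] X) : Prop :=
  ∀ x y : X, (x, y) ∈ A.graph ↔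
    Filter.Tendsto (fun t : ℝ≥0 => (t : ℝ)⁻¹ • (T t x - x)) (𝓝[>] 0) (𝓝 y)

/-- `A` generates an exponentially stable strongly continuous semigroup:
`‖e^{At}‖ ≤ c e^{-βt}` for all `t ≥ 0`, with some `c, β > 0`. -/
def GeneratesExpStable (A : X →ₗ.[ℂ] X) : Prop :=
  ∃ T : ℝ≥0 → X →L[ℂ] X, IsC0Semigroup T ∧ IsGenerator A T ∧
    ∃ c β : ℝ, 0 < c ∧ 0 < β ∧ ∀ t : ℝ≥0, ‖T t‖ ≤ c * Real.exp (-β * t)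

end Semigroups

section SecondOrder

variable {Y : Type*} [NormedAddCommGroup Y] [InnerProductSpace ℂ Y]

/-- Sectorial bounded operators: the numerical range lies in a sector
`{ζ : |arg ζ| ≤ θ}` with `θ < π/2` (with vertex `0`; in particular, the operator is accretive). -/
def IsSectorial (C : Y →L[ℂ] Y) : Prop :=
  ∃ θ : ℝ, θ < Real.pi / 2 ∧ ∀ y : Y, |(⟪y, C y⟫_ℂ).arg| ≤ θ

/-- The operator `(x₁, x₂) ↦ (-C x₁ - S x₂, S x₁)` with domain `D(S) ⊕ D(S)` in the Hilbert space
`Y ⊕ Y`, where `S` stands for `M^{1/2}`. -/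
def blockOp (S : Y →ₗ.[ℂ] Y) (C : Y →L[ℂ] Y) :
    WithLp 2 (Y × Y) →ₗ.[ℂ] WithLp 2 (Y × Y) where
  domain := (S.domain.prod S.domain).comap (WithLp.linearEquiv 2 ℂ (Y × Y)).toLinearMap
  toFun :=
    { toFun := fun z => WithLp.toLp 2
        (-C (z : WithLp 2 (Y × Y)).fst - S ⟨(z : WithLp 2 (Y × Y)).snd, z.2.2⟩,
          S ⟨(z : WithLp 2 (Y × Y)).fst, z.2.1⟩)
      map_add' := fun z w => by
        have h1 := S.map_add ⟨(z : WithLp 2 (Y × Y)).fst, z.2.1⟩ ⟨(w : WithLp 2 (Y × Y)).fst, w.2.1⟩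
        have h2 := S.map_add ⟨(z : WithLp 2 (Y × Y)).snd, z.2.2⟩ ⟨(w : WithLp 2 (Y × Y)).snd, w.2.2⟩
        rw [← WithLp.toLp_add, Prod.mk_add_mk]
        congr 2
        · refine (congrArg₂ (fun a b : Y => -a - b)
            (C.map_add (z : WithLp 2 (Y × Y)).fst (w : WithLp 2 (Y × Y)).fst) h2).trans ?_
          abel
      map_smul' := fun c z => by
        have h1 := S.map_smul c ⟨(z : WithLp 2 (Y × Y)).fst, z.2.1⟩
        have h2 := S.map_smul c ⟨(z : WithLp 2 (Y × Y)).snd, z.2.2⟩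
        rw [RingHom.id_apply, ← WithLp.toLp_smul, Prod.smul_mk]
        congr 2
        · refine (congrArg₂ (fun a b : Y => -a - b)
            (C.map_smul c (z : WithLp 2 (Y × Y)).fst) h2).trans ?_
          rw [smul_sub, smul_neg] }

variable [CompleteSpace Y] (M : Y →ₗ.[ℂ] Y) (hM : IsPosSelfAdjoint M) (C : Y →L[ℂ] Y)

/-- The phase space operator `𝒜⁺ = [[-C, -M^{1/2}], [M^{1/2}, 0]]` in `Y ⊕ Y`. -/
def phaseOp : WithLp 2 (Y × Y) →ₗ.[ℂ] WithLp 2 (Y × Y) :=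
  blockOp (posSqrt M hM) C

/-- The physical phase space `𝒳`, the orthogonal complement of the null-space of `𝒜⁺`. -/
def physicalSpace : Submodule ℂ (WithLp 2 (Y × Y)) :=
  (nullSpace (phaseOp M hM C))ᗮ

/-- The operator `𝒜` in `𝒳` attached to `M ÿ + C ẏ + y = 0`: the inverse of the
(injective) part of `𝒜⁺` in `𝒳`. -/
def systemOp : physicalSpace M hM C →ₗ.[ℂ] physicalSpace M hM C :=
  (partIn (phaseOp M hM C) (physicalSpace M hM C)).inverse

/-- Exponential stability of the system `M ÿ + C ẏ + y = 0`, i.e. of the semigroup on `𝒳`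
generated by `𝒜`. -/
def SystemExpStable : Prop :=
  GeneratesExpStable (systemOp M hM C)

end SecondOrder

end DampedSystem

end

open scoped NNReal Topology InnerProductSpace

noncomputable section

/-! Since 𝒜 is an inverse, u' = 𝒜u means u = 𝒜⁺u'. The terms with M^{1/2} cancel in Re(u, u'), so
(‖u‖²)' = -2 h(u') with h(y) = Re(C y₁, y₁): dissipation sees only the real part of C. It therefore
suffices to compare two sectorial C₁, C₂ with the same real part. If h vanishes at a vector,
sectoriality makes both C and C* vanish at its first component; hence the null-spaces agree and both
systems live in the same 𝒳.

Let u, v solve the systems for C₁, C₂ with the same initial value x, and put w = u - v. With E y =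
((C₂ - C₁)y₁, 0) one has 𝒜₁⁺w' = w - E v', so (‖w‖²)' = -2h(w') + 2 Re(E v', w'). Sectoriality gives
Re(E y, z) ≤ h(z) + k h(y), hence (‖w‖²)' ≤ 2k h(v') = -k(‖v‖²)', and ‖u - v‖² + k‖v‖² ≤ k‖x‖². If
the first semigroup has norm at most 1/2 at time τ, then v(τ) cannot keep almost all of its norm,
since it would then be far from u(τ). So the second semigroup has norm below 1 at τ and decays
exponentially. The argument is symmetric in C₁ and C₂.

To avoid differentiating irregular orbits, the comparison is made for Yosida approximations, where
the extra terms have a favourable sign, and then passed to the limit. The same limit constructs the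
second semigroup and is identified with the given first one.

The carrying lemmas are `norm_exp_sub_sq_add_le`, `GeneratesExpStable.of_comparison`,
`HasSectorBound.exists_re_inner_sub_le` and `isMDissipative_inverse_partIn_blockOp`. -/

namespace DampedSystem

/-! ### m-dissipative operators and their Yosida approximations -/

section Yosida

open Filter

attribute [local instance] InnerProductSpace.complexToReal

variable {X : Type*} [NormedAddCommGroup X] [InnerProductSpace ℂ X]

/-- Densely defined `m`-dissipative operators. -/
structure IsMDissipative (A : X →ₗ.[ℂ] X) : Prop where
  inner_nonpos : ∀ {x y}, (x, y) ∈ A.graph → ⟪x, y⟫_ℝ ≤ 0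
  exists_sub_smul_eq : ∀ ε : ℝ, 0 < ε → ∀ f, ∃ x y, (x, y) ∈ A.graph ∧ x - ε • y = f
  dense_domain : Dense {x | ∃ y, (x, y) ∈ A.graph}

/-- `Y` is the Yosida approximation `A (1 - ε A)⁻¹` of `A`. -/
def IsYosida (A : X →ₗ.[ℂ] X) (ε : ℝ) (Y : X →L[ℂ] X) : Prop :=
  ∀ f, (f + ε • Y f, Y f) ∈ A.graph

/-- The cross term of the expanded square is nonnegative by dissipativity. This one estimate gives
injectivity of 1 - εA and all resolvent bounds. -/
theorem IsMDissipative.norm_sub_smul_sq_ge {A : X →ₗ.[ℂ] X} (hA : IsMDissipative A) {ε : ℝ}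
    (hε : 0 < ε) {x y : X} (h : (x, y) ∈ A.graph) :
    ‖x‖ ^ 2 + (ε * ‖y‖) ^ 2 ≤ ‖x - ε • y‖ ^ 2 := by
  have h1 := hA.inner_nonpos h
  have h2 := norm_sub_sq_real x (ε • y)
  rw [real_inner_smul_right, norm_smul, Real.norm_of_nonneg hε.le] at h2
  nlinarith

theorem IsMDissipative.eq_of_sub_smul_eq {A : X →ₗ.[ℂ] X} (hA : IsMDissipative A) {ε : ℝ}
    (hε : 0 < ε) {x y x' y' : X} (h : (x, y) ∈ A.graph) (h' : (x', y') ∈ A.graph)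
    (e : x - ε • y = x' - ε • y') : x = x' ∧ y = y' := by
  have h1 := hA.norm_sub_smul_sq_ge hε (A.graph.sub_mem h h')
  have h2 : x - x' - ε • (y - y') = 0 := by
    rw [smul_sub]
    have := sub_eq_zero.2 e
    rw [← this]; abel
  rw [h2, norm_zero] at h1
  have h3 : ‖x - x'‖ = 0 := by nlinarith [norm_nonneg (x - x'), sq_nonneg (ε * ‖y - y'‖)]
  have h4 : x = x' := sub_eq_zero.1 (norm_eq_zero.1 h3)
  exact ⟨h4, A.mem_graph_snd_inj h h' h4⟩

theorem IsMDissipative.exists_isYosida {A : X →ₗ.[ℂ] X} (hA : IsMDissipative A) {ε : ℝ}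
    (hε : 0 < ε) : ∃ Y, IsYosida A ε Y := by
  choose p q hpq hf using hA.exists_sub_smul_eq ε hε
  refine ⟨LinearMap.mkContinuous
    { toFun := q
      map_add' := fun f g => ?_
      map_smul' := fun c f => ?_ } ε⁻¹ fun f => ?_, fun f => ?_⟩
  · refine (hA.eq_of_sub_smul_eq hε (hpq _) (A.graph.add_mem (hpq f) (hpq g)) ?_).2
    change _ = p f + p g - ε • (q f + q g)
    rw [hf]
    nth_rewrite 1 [← hf f, ← hf g]
    rw [smul_add]; abel
  · refine (hA.eq_of_sub_smul_eq hε (hpq _) (A.graph.smul_mem c (hpq f)) ?_).2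
    change _ = c • p f - ε • (c • q f)
    rw [hf]
    nth_rewrite 1 [← hf f]
    rw [smul_sub, smul_comm]
  · change ‖q f‖ ≤ ε⁻¹ * ‖f‖
    have h := hA.norm_sub_smul_sq_ge hε (hpq f)
    rw [hf] at h
    rw [inv_mul_eq_div, le_div_iff₀ hε, mul_comm]
    exact le_of_sq_le_sq (by nlinarith [sq_nonneg ‖p f‖]) (norm_nonneg f)
  · change (f + ε • q f, q f) ∈ A.graph
    nth_rewrite 1 [← hf f]
    rw [sub_add_cancel]
    exact hpq f

section

variable {A : X →ₗ.[ℂ] X} {ε : ℝ} {Y : X →L[ℂ] X}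

theorem IsYosida.apply_sub (hY : IsYosida A ε Y) (hA : IsMDissipative A) (hε : 0 < ε) {x y : X}
    (h : (x, y) ∈ A.graph) : Y (x - ε • y) = y :=
  (hA.eq_of_sub_smul_eq hε (hY _) h (by abel)).2

theorem IsYosida.apply_eq (hY : IsYosida A ε Y) (hA : IsMDissipative A) (hε : 0 < ε) {x y : X}
    (h : (x, y) ∈ A.graph) : Y x = y + ε • Y y := by
  have := hY.apply_sub hA hε h
  rw [map_sub, sub_eq_iff_eq_add] at this
  rw [this, ← Complex.coe_smul, ← Complex.coe_smul, map_smul]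

theorem IsYosida.inner_apply_nonpos (hY : IsYosida A ε Y) (hA : IsMDissipative A) (hε : 0 < ε)
    (f : X) : ⟪f, Y f⟫_ℝ ≤ 0 := by
  have := hA.inner_nonpos (hY f)
  rw [inner_add_left, real_inner_smul_left, real_inner_self_eq_norm_sq] at this
  nlinarith [sq_nonneg ‖Y f‖]

theorem IsYosida.norm_smul_apply_le (hY : IsYosida A ε Y) (hA : IsMDissipative A) (hε : 0 < ε)
    (f : X) : ‖(ε • Y) f‖ ≤ ‖f‖ := by
  have h := hA.norm_sub_smul_sq_ge hε (hY f)
  rw [add_sub_cancel_right] at h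
  rw [smul_apply, norm_smul, Real.norm_of_nonneg hε.le]
  exact le_of_sq_le_sq (by nlinarith [sq_nonneg ‖f + ε • Y f‖]) (norm_nonneg f)

/-- An operator preserving the graph of `A` sends a solution of x - εy = f to the solution for its
image, and that solution is unique. -/
theorem IsYosida.commute (hY : IsYosida A ε Y) (hA : IsMDissipative A) (hε : 0 < ε)
    {T : X →L[ℂ] X} (hT : ∀ x y, (x, y) ∈ A.graph → (T x, T y) ∈ A.graph) : Commute Y T := by
  ext f
  change Y (T f) = T (Y f)
  have h := hY.apply_sub hA hε (hT _ _ (hY f))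
  rwa [map_add, ← Complex.coe_smul, map_smul, Complex.coe_smul, add_sub_cancel_right] at h

theorem IsYosida.apply_mem_graph (hY : IsYosida A ε Y) (hA : IsMDissipative A) (hε : 0 < ε)
    (x y : X) (h : (x, y) ∈ A.graph) : (Y x, Y y) ∈ A.graph := by
  rw [hY.apply_eq hA hε h]
  exact hY y

end

/-! ### Exponentials of bounded dissipative operators -/

section Exp

variable [CompleteSpace X]

theorem hasDerivAt_exp_smul_apply (Y : X →L[ℂ] X) (x : X) (t : ℝ) :
    HasDerivAt (fun s : ℝ => NormedSpace.exp (s • Y) x) (Y (NormedSpace.exp (t • Y) x)) t := by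
  let L : (X →L[ℂ] X) →L[ℝ] X :=
    (ContinuousLinearMap.apply ℂ X x).restrictScalars ℝ
  exact L.hasFDerivAt.comp_hasDerivAt t (hasDerivAt_exp_smul_const' (𝕂 := ℝ) Y t)

theorem norm_exp_smul_apply_le {Y : X →L[ℂ] X} (hY : ∀ f, ⟪f, Y f⟫_ℝ ≤ 0) {t : ℝ} (ht : 0 ≤ t)
    (x : X) : ‖NormedSpace.exp (t • Y) x‖ ≤ ‖x‖ := by
  have h : Antitone fun s : ℝ => ‖NormedSpace.exp (s • Y) x‖ ^ 2 :=
    antitone_of_hasDerivAt_nonpos (fun s => (hasDerivAt_exp_smul_apply Y x s).norm_sq)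
      fun s => mul_nonpos_of_nonneg_of_nonpos zero_le_two (hY _)
  have := h ht
  simp only [zero_smul, NormedSpace.exp_zero, one_apply_eq_self] at this
  exact le_of_sq_le_sq this (norm_nonneg x)

/-- Approximate solutions of `u' = Y u` stay close to `exp (t Y) (u 0)`. -/
theorem norm_sub_exp_smul_apply_le {Y : X →L[ℂ] X} (hY : ∀ f, ⟪f, Y f⟫_ℝ ≤ 0) {u u' : ℝ → X}
    {K t : ℝ} (ht : 0 ≤ t) (hu : ContinuousOn u (Set.Icc 0 t))
    (hu' : ∀ s, 0 ≤ s → HasDerivWithinAt u (u' s) (Set.Ici s) s)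
    (hK : ∀ s, 0 ≤ s → ‖u' s - Y (u s)‖ ≤ K) :
    ‖u t - NormedSpace.exp (t • Y) (u 0)‖ ≤ K * t := by
  have hd : ∀ s, HasDerivAt (fun s : ℝ => NormedSpace.exp ((t - s) • Y))
      (-(NormedSpace.exp ((t - s) • Y) * Y)) s := by
    intro s
    have h1 : HasDerivAt (fun s : ℝ => t - s) (-1) s := by
      simpa using (hasDerivAt_id s).const_sub t
    have h2 := (hasDerivAt_exp_smul_const (𝕂 := ℝ) Y (t - s)).scomp s h1
    simpa [Function.comp_def] using h2
  -- The path `u` is differentiable only in a real variable, so the product rule is applied to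
  -- real-linear maps. The derivative of exp((t - s)Y) u(s) is exp((t - s)Y)(u' - Y u), and the
  -- exponential is a contraction for s ≤ t.
  let R : (X →L[ℂ] X) →L[ℝ] (X →L[ℝ] X) := ContinuousLinearMap.restrictScalarsL ℂ X X ℝ ℝ
  have hR : ∀ s, HasDerivAt (fun s : ℝ => R (NormedSpace.exp ((t - s) • Y)))
      (R (-(NormedSpace.exp ((t - s) • Y) * Y))) s := fun s =>
    R.hasFDerivAt.comp_hasDerivAt s (hd s)
  have key := norm_image_sub_le_of_norm_deriv_right_le_segment
    (f := fun s => R (NormedSpace.exp ((t - s) • Y)) (u s)) (a := 0) (b := t)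
    (f' := fun s => NormedSpace.exp ((t - s) • Y) (u' s - Y (u s))) (C := K) ?_ ?_ ?_ t
    ⟨ht, le_rfl⟩
  · simpa [R] using key
  · refine ContinuousOn.clm_apply ?_ hu
    exact fun s _ => (hR s).continuousAt.continuousWithinAt
  · intro s hs
    convert ((hR s).hasDerivWithinAt (s := Set.Ici s)).clm_apply (hu' s hs.1) using 1
    change _ = -(NormedSpace.exp ((t - s) • Y) (Y (u s))) + NormedSpace.exp ((t - s) • Y) (u' s)
    rw [map_sub]; abel
  · intro s hs
    exact (norm_exp_smul_apply_le hY (sub_nonneg.2 hs.2.le) _).trans (hK s hs.1)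

theorem commute_exp_smul_apply {Y T : X →L[ℂ] X} (h : Commute Y T) (t : ℝ) (x : X) :
    T (NormedSpace.exp (t • Y) x) = NormedSpace.exp (t • Y) (T x) :=
  DFunLike.congr_fun (Commute.exp_right (h.symm.smul_right t)).eq x

/-- By commutation, the defect of exp(sZ)x as a solution of u' = Yu is exp(sZ)(Zx - Yx), which is
bounded uniformly in s. -/
theorem norm_exp_smul_apply_sub_le {Y Z : X →L[ℂ] X} (hY : ∀ f, ⟪f, Y f⟫_ℝ ≤ 0)
    (hZ : ∀ f, ⟪f, Z f⟫_ℝ ≤ 0) (hc : Commute Y Z) {t : ℝ} (ht : 0 ≤ t) (x : X) :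
    ‖NormedSpace.exp (t • Z) x - NormedSpace.exp (t • Y) x‖ ≤ ‖Z x - Y x‖ * t := by
  have h := norm_sub_exp_smul_apply_le hY (u := fun s => NormedSpace.exp (s • Z) x)
    (u' := fun s => Z (NormedSpace.exp (s • Z) x)) (K := ‖Z x - Y x‖) ht
    (fun s _ => (hasDerivAt_exp_smul_apply Z x s).continuousAt.continuousWithinAt)
    (fun s _ => (hasDerivAt_exp_smul_apply Z x s).hasDerivWithinAt)
    (fun s hs => ?_)
  · simpa using h
  · rw [commute_exp_smul_apply (Commute.refl Z), commute_exp_smul_apply hc.symm, ← map_sub]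
    exact norm_exp_smul_apply_le hZ hs _

/-- The shifted orbit solves u' = Yu exactly, so the comparison estimate applies with zero error. -/
theorem exp_smul_add_apply {Y : X →L[ℂ] X} (hY : ∀ f, ⟪f, Y f⟫_ℝ ≤ 0) {t : ℝ} (ht : 0 ≤ t)
    (r : ℝ) (x : X) : NormedSpace.exp ((t + r) • Y) x =
      NormedSpace.exp (t • Y) (NormedSpace.exp (r • Y) x) := by
  have hd : ∀ s, HasDerivAt (fun s : ℝ => NormedSpace.exp ((s + r) • Y) x)
      (Y (NormedSpace.exp ((s + r) • Y) x)) s := fun s =>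
    (hasDerivAt_exp_smul_apply Y x (s + r)).comp_add_const s r
  have h := norm_sub_exp_smul_apply_le hY (u := fun s => NormedSpace.exp ((s + r) • Y) x)
    (u' := fun s => Y (NormedSpace.exp ((s + r) • Y) x)) (K := 0) ht
    (fun s _ => (hd s).continuousAt.continuousWithinAt)
    (fun s _ => (hd s).hasDerivWithinAt) (fun s _ => by simp)
  rw [zero_mul, norm_le_zero_iff, sub_eq_zero, zero_add] at h
  exact h

theorem norm_exp_smul_apply_sub_self_le {Y : X →L[ℂ] X} (hY : ∀ f, ⟪f, Y f⟫_ℝ ≤ 0) {t : ℝ}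
    (ht : 0 ≤ t) (x : X) : ‖NormedSpace.exp (t • Y) x - x‖ ≤ ‖Y x‖ * t := by
  have := norm_exp_smul_apply_sub_le (Y := 0) (Z := Y) (by simp) hY (Commute.zero_left Y) ht x
  simpa using this

/-- A first-order expansion with no Y²x in the error: `z` is a regular substitute for Yx. In the
limit Y → A this asks only that `z` lie in the domain of A, while Ax need not. -/
theorem norm_exp_smul_apply_sub_sub_le {Y : X →L[ℂ] X} (hY : ∀ f, ⟪f, Y f⟫_ℝ ≤ 0) {t : ℝ}
    (ht : 0 ≤ t) (x z : X) :
    ‖NormedSpace.exp (t • Y) x - x - t • Y x‖ ≤ (2 * ‖Y x - z‖ + ‖Y z‖ * t) * t := by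
  have hd : ∀ s, HasDerivAt (fun s : ℝ => NormedSpace.exp (s • Y) x - s • Y x)
      (NormedSpace.exp (s • Y) (Y x) - Y x) s := by
    intro s
    rw [← commute_exp_smul_apply (Commute.refl Y)]
    simpa using (hasDerivAt_exp_smul_apply Y x s).fun_sub ((hasDerivAt_id s).smul_const (Y x))
  have h := norm_image_sub_le_of_norm_deriv_right_le_segment
    (f := fun s : ℝ => NormedSpace.exp (s • Y) x - s • Y x) (a := 0) (b := t)
    (f' := fun s => NormedSpace.exp (s • Y) (Y x) - Y x) (C := 2 * ‖Y x - z‖ + ‖Y z‖ * t)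
    (fun s _ => (hd s).continuousAt.continuousWithinAt) (fun s _ => (hd s).hasDerivWithinAt) ?_ t
    ⟨ht, le_rfl⟩
  · simpa [sub_right_comm] using h
  · intro s hs
    have h1 := norm_exp_smul_apply_le hY hs.1 (Y x - z)
    have h2 := norm_exp_smul_apply_sub_self_le hY hs.1 z
    have h3 : NormedSpace.exp (s • Y) (Y x) - Y x =
        NormedSpace.exp (s • Y) (Y x - z) + (NormedSpace.exp (s • Y) z - z) - (Y x - z) := by
      rw [map_sub]; abel
    have h4 := norm_sub_le (NormedSpace.exp (s • Y) (Y x - z) + (NormedSpace.exp (s • Y) z - z))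
      (Y x - z)
    have h5 := norm_add_le (NormedSpace.exp (s • Y) (Y x - z)) (NormedSpace.exp (s • Y) z - z)
    have h6 : ‖Y z‖ * s ≤ ‖Y z‖ * t := mul_le_mul_of_nonneg_left hs.2.le (norm_nonneg _)
    rw [h3]
    linarith

end Exp

end Yosida

/-! ### Generation of a contraction semigroup by the Yosida limit -/

section Generation

open Filter

attribute [local instance] InnerProductSpace.complexToReal

variable {X : Type*} [NormedAddCommGroup X] [InnerProductSpace ℂ X]

theorem cauchySeq_apply_of_dense {g : ℕ → X →L[ℂ] X} (hg : ∀ n x, ‖g n x‖ ≤ ‖x‖) {D : Set X}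
    (hD : Dense D) (h : ∀ x ∈ D, CauchySeq fun n => g n x) (x : X) :
    CauchySeq fun n => g n x := by
  rw [Metric.cauchySeq_iff]
  intro η hη
  obtain ⟨y, hy, hyx⟩ := hD.exists_dist_lt x (show 0 < η / 3 by positivity)
  obtain ⟨N, hN⟩ := Metric.cauchySeq_iff.1 (h y hy) (η / 3) (by positivity)
  refine ⟨N, fun m hm n hn => ?_⟩
  have h1 := hN m hm n hn
  have h2 : ∀ k, dist (g k x) (g k y) < η / 3 := fun k => by
    rw [dist_eq_norm, ← map_sub]
    exact (hg k _).trans_lt (by rwa [← dist_eq_norm])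
  have h3 := dist_triangle4 (g m x) (g m y) (g n y) (g n x)
  have h4 := h2 n
  rw [dist_comm] at h4
  linarith [h2 m]

theorem exists_tendsto_apply [CompleteSpace X] {g : ℕ → X →L[ℂ] X} (hg : ∀ n x, ‖g n x‖ ≤ ‖x‖)
    {D : Set X} (hD : Dense D) (h : ∀ x ∈ D, CauchySeq fun n => g n x) :
    ∃ L : X →L[ℂ] X, ∀ x, Tendsto (fun n => g n x) atTop (𝓝 (L x)) := by
  choose f hf using fun x => cauchySeq_tendsto_of_complete (cauchySeq_apply_of_dense hg hD h x)
  exact ⟨continuousLinearMapOfTendsto g (tendsto_pi_nhds.2 hf), hf⟩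

theorem tendsto_apply_of_dense [CompleteSpace X] {g : ℕ → X →L[ℂ] X} (hg : ∀ n x, ‖g n x‖ ≤ ‖x‖)
    {D : Set X} (hD : Dense D) {L : X →L[ℂ] X}
    (h : ∀ x ∈ D, Tendsto (fun n => g n x) atTop (𝓝 (L x))) (x : X) :
    Tendsto (fun n => g n x) atTop (𝓝 (L x)) := by
  obtain ⟨L', hL'⟩ := exists_tendsto_apply hg hD fun y hy => (h y hy).cauchySeq
  have : (L' : X → X) = L := Continuous.ext_on hD L'.continuous L.continuous fun y hy =>
    tendsto_nhds_unique (hL' y) (h y hy)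
  rw [← this]
  exact hL' x

/-- A sequence of Yosida approximations of `A` with parameters tending to `0`. -/
def IsYosidaSeq (A : X →ₗ.[ℂ] X) (Y : ℕ → X →L[ℂ] X) : Prop :=
  ∀ n : ℕ, IsYosida A (1 / ((n : ℝ) + 1)) (Y n)

theorem IsMDissipative.exists_isYosidaSeq {A : X →ₗ.[ℂ] X} (hA : IsMDissipative A) :
    ∃ Y, IsYosidaSeq A Y := by
  choose Y hY using fun n : ℕ => hA.exists_isYosida (Nat.one_div_pos_of_nat (α := ℝ) (n := n))
  exact ⟨Y, hY⟩

namespace IsYosidaSeq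

variable {A : X →ₗ.[ℂ] X} {Y : ℕ → X →L[ℂ] X}

theorem inner_apply_nonpos (hY : IsYosidaSeq A Y) (hA : IsMDissipative A) (n : ℕ) (f : X) :
    ⟪f, Y n f⟫_ℝ ≤ 0 :=
  (hY n).inner_apply_nonpos hA Nat.one_div_pos_of_nat f

/-- On the domain of A the quantity εYx is O(ε); uniform contractivity of εY extends the convergence
by density. -/
theorem tendsto_smul_apply [CompleteSpace X] (hY : IsYosidaSeq A Y) (hA : IsMDissipative A)
    (y : X) : Tendsto (fun n : ℕ => (1 / ((n : ℝ) + 1)) • Y n y) atTop (𝓝 0) := by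
  refine tendsto_apply_of_dense (g := fun n : ℕ => (1 / ((n : ℝ) + 1)) • Y n) (L := 0)
    (fun n x => (hY n).norm_smul_apply_le hA Nat.one_div_pos_of_nat x) hA.dense_domain ?_ y
  rintro x ⟨z, hz⟩
  have h0 : Tendsto (fun n : ℕ => (1 / ((n : ℝ) + 1)) * (2 * ‖z‖)) atTop (𝓝 0) := by
    simpa using (tendsto_one_div_add_atTop_nhds_zero_nat (𝕜 := ℝ)).mul_const (2 * ‖z‖)
  refine squeeze_zero_norm (fun n => ?_) h0
  have hn : 0 < 1 / ((n : ℝ) + 1) := Nat.one_div_pos_of_nat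
  have h1 := (hY n).norm_smul_apply_le hA hn z
  rw [smul_apply, (hY n).apply_eq hA hn hz, norm_smul, Real.norm_of_nonneg hn.le]
  refine mul_le_mul_of_nonneg_left ?_ hn.le
  calc _ ≤ ‖z‖ + ‖(1 / ((n : ℝ) + 1)) • Y n z‖ := norm_add_le _ _
    _ ≤ _ := by rw [smul_apply] at h1; linarith

theorem tendsto_apply [CompleteSpace X] (hY : IsYosidaSeq A Y) (hA : IsMDissipative A) {x y : X}
    (h : (x, y) ∈ A.graph) : Tendsto (fun n => Y n x) atTop (𝓝 y) := by
  have h1 : ∀ n, Y n x = y + (1 / ((n : ℝ) + 1)) • Y n y := fun n =>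
    (hY n).apply_eq hA Nat.one_div_pos_of_nat h
  simp_rw [h1]
  simpa using (hY.tendsto_smul_apply hA y).const_add y

theorem commute (hY : IsYosidaSeq A Y) (hA : IsMDissipative A) (m n : ℕ) :
    Commute (Y m) (Y n) :=
  (hY m).commute hA Nat.one_div_pos_of_nat ((hY n).apply_mem_graph hA Nat.one_div_pos_of_nat)

theorem exists_tendsto_exp [CompleteSpace X] (hY : IsYosidaSeq A Y) (hA : IsMDissipative A) :
    ∃ T : ℝ≥0 → X →L[ℂ] X, ∀ (t : ℝ≥0) (x : X),
      Tendsto (fun n => NormedSpace.exp ((t : ℝ) • Y n) x) atTop (𝓝 (T t x)) := by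
  have key : ∀ t : ℝ≥0, ∃ L : X →L[ℂ] X, ∀ x,
      Tendsto (fun n => NormedSpace.exp ((t : ℝ) • Y n) x) atTop (𝓝 (L x)) := by
    intro t
    refine exists_tendsto_apply
      (fun n x => norm_exp_smul_apply_le (hY.inner_apply_nonpos hA n) t.coe_nonneg x) hA.dense_domain ?_
    rintro x ⟨y, hxy⟩
    have hc := (hY.tendsto_apply hA hxy).cauchySeq
    rw [Metric.cauchySeq_iff] at hc ⊢
    intro η hη
    obtain ⟨N, hN⟩ := hc (η / ((t : ℝ) + 1)) (by positivity)
    refine ⟨N, fun m hm n hn => ?_⟩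
    have h1 := hN m hm n hn
    rw [dist_eq_norm, lt_div_iff₀ (by positivity)] at h1
    rw [dist_eq_norm]
    have h2 := norm_exp_smul_apply_sub_le (hY.inner_apply_nonpos hA n)
      (hY.inner_apply_nonpos hA m) (hY.commute hA n m) t.coe_nonneg x
    nlinarith [norm_nonneg (Y m x - Y n x)]
  choose T hT using key
  exact ⟨T, hT⟩

variable {T : ℝ≥0 → X →L[ℂ] X} [CompleteSpace X]

theorem norm_limit_apply_le (hY : IsYosidaSeq A Y) (hA : IsMDissipative A)
    (hT : ∀ (t : ℝ≥0) (x : X),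
      Tendsto (fun n => NormedSpace.exp ((t : ℝ) • Y n) x) atTop (𝓝 (T t x)))
    (t : ℝ≥0) (x : X) : ‖T t x‖ ≤ ‖x‖ :=
  le_of_tendsto (hT t x).norm (Eventually.of_forall fun n =>
    norm_exp_smul_apply_le (hY.inner_apply_nonpos hA n) t.coe_nonneg x)

theorem limit_add_apply (hY : IsYosidaSeq A Y) (hA : IsMDissipative A)
    (hT : ∀ (t : ℝ≥0) (x : X),
      Tendsto (fun n => NormedSpace.exp ((t : ℝ) • Y n) x) atTop (𝓝 (T t x)))
    (s t : ℝ≥0) (x : X) : T (s + t) x = T s (T t x) := by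
  have h1 := hT (s + t) x
  have h2 : ∀ n, NormedSpace.exp (((s + t : ℝ≥0) : ℝ) • Y n) x =
      NormedSpace.exp ((s : ℝ) • Y n) (T t x) +
        NormedSpace.exp ((s : ℝ) • Y n) (NormedSpace.exp ((t : ℝ) • Y n) x - T t x) := fun n => by
    rw [NNReal.coe_add, exp_smul_add_apply (hY.inner_apply_nonpos hA n) s.coe_nonneg, map_sub]
    abel
  simp_rw [h2] at h1
  have h3 : Tendsto (fun n => NormedSpace.exp ((t : ℝ) • Y n) x - T t x) atTop (𝓝 0) := by
    simpa using (hT t x).sub_const (T t x)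
  have h4 : Tendsto (fun n => NormedSpace.exp ((s : ℝ) • Y n)
      (NormedSpace.exp ((t : ℝ) • Y n) x - T t x)) atTop (𝓝 0) :=
    squeeze_zero_norm (fun n => norm_exp_smul_apply_le (hY.inner_apply_nonpos hA n) s.coe_nonneg _)
      (by simpa using h3.norm)
  have h5 := (hT s (T t x)).add h4
  rw [add_zero] at h5
  exact tendsto_nhds_unique h1 h5

theorem norm_limit_apply_sub_le (hY : IsYosidaSeq A Y) (hA : IsMDissipative A)
    (hT : ∀ (t : ℝ≥0) (x : X),
      Tendsto (fun n => NormedSpace.exp ((t : ℝ) • Y n) x) atTop (𝓝 (T t x)))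
    {x y : X} (h : (x, y) ∈ A.graph) (t : ℝ≥0) : ‖T t x - x‖ ≤ ‖y‖ * t :=
  le_of_tendsto_of_tendsto ((hT t x).sub_const x).norm
    ((hY.tendsto_apply hA h).norm.mul_const (t : ℝ)) (Eventually.of_forall fun n =>
      norm_exp_smul_apply_sub_self_le (hY.inner_apply_nonpos hA n) t.coe_nonneg x)

theorem isC0Semigroup_limit (hY : IsYosidaSeq A Y) (hA : IsMDissipative A)
    (hT : ∀ (t : ℝ≥0) (x : X),
      Tendsto (fun n => NormedSpace.exp ((t : ℝ) • Y n) x) atTop (𝓝 (T t x))) :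
    IsC0Semigroup T where
  map_zero := by
    ext x
    refine tendsto_nhds_unique (hT 0 x) ?_
    simp
  map_add s t := by
    ext x
    exact hY.limit_add_apply hA hT s t x
  continuous x := by
    -- Orbits starting in the domain are Lipschitz, and by contractivity every orbit is a uniform
    -- limit of such orbits.
    refine continuous_of_uniform_approx_of_continuous fun u hu => ?_
    obtain ⟨η, hη, hηu⟩ := Metric.mem_uniformity_dist.1 hu
    obtain ⟨z, ⟨y, hzy⟩, hz⟩ := hA.dense_domain.exists_dist_lt x hη
    refine ⟨fun t => T t z, ?_, fun t => hηu ?_⟩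
    · have hle : ∀ s r : ℝ≥0, ‖T (s + r) z - T s z‖ ≤ ‖y‖ * r := by
        intro s r
        rw [hY.limit_add_apply hA hT, ← map_sub]
        exact (hY.norm_limit_apply_le hA hT s _).trans (hY.norm_limit_apply_sub_le hA hT hzy r)
      have hlip : LipschitzWith ‖y‖₊ fun t => T t z := by
        refine LipschitzWith.of_dist_le_mul fun s t => ?_
        wlog hst : s ≤ t generalizing s t
        · rw [dist_comm, dist_comm s]
          exact this t s (le_of_not_ge hst)
        obtain ⟨r, rfl⟩ := exists_add_of_le hst
        rw [dist_comm, dist_eq_norm, NNReal.dist_eq, NNReal.coe_add, sub_add_cancel_left, abs_neg,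
          abs_of_nonneg r.coe_nonneg]
        exact hle s r
      exact hlip.continuous
    · rw [dist_eq_norm, ← map_sub]
      exact (hY.norm_limit_apply_le hA hT t _).trans_lt (by rwa [← dist_eq_norm])

theorem norm_limit_apply_sub_sub_le (hY : IsYosidaSeq A Y) (hA : IsMDissipative A)
    (hT : ∀ (t : ℝ≥0) (x : X),
      Tendsto (fun n => NormedSpace.exp ((t : ℝ) • Y n) x) atTop (𝓝 (T t x)))
    {x y z w : X} (h : (x, y) ∈ A.graph) (h' : (z, w) ∈ A.graph) (t : ℝ≥0) :
    ‖T t x - x - (t : ℝ) • y‖ ≤ (2 * ‖y - z‖ + ‖w‖ * t) * t := by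
  have hx := hY.tendsto_apply hA h
  have hz := hY.tendsto_apply hA h'
  exact le_of_tendsto_of_tendsto (((hT t x).sub_const x).sub (hx.const_smul (t : ℝ))).norm
    ((((hx.sub_const z).norm.const_mul 2).add (hz.norm.mul_const (t : ℝ))).mul_const (t : ℝ))
    (Eventually.of_forall fun n =>
      norm_exp_smul_apply_sub_sub_le (hY.inner_apply_nonpos hA n) t.coe_nonneg x z)

theorem tendsto_limit_quotient (hY : IsYosidaSeq A Y) (hA : IsMDissipative A)
    (hT : ∀ (t : ℝ≥0) (x : X),
      Tendsto (fun n => NormedSpace.exp ((t : ℝ) • Y n) x) atTop (𝓝 (T t x)))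
    {x y : X} (h : (x, y) ∈ A.graph) :
    Tendsto (fun t : ℝ≥0 => (t : ℝ)⁻¹ • (T t x - x)) (𝓝[>] 0) (𝓝 y) := by
  rw [Metric.tendsto_nhds]
  intro η hη
  obtain ⟨z, ⟨w, hzw⟩, hz⟩ := hA.dense_domain.exists_dist_lt y (show 0 < η / 4 by positivity)
  rw [dist_eq_norm] at hz
  have h0 : Tendsto (fun t : ℝ≥0 => ‖w‖ * (t : ℝ)) (𝓝[>] 0) (𝓝 0) := by
    have : Continuous fun t : ℝ≥0 => ‖w‖ * (t : ℝ) := by fun_prop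
    simpa using (this.continuousWithinAt (s := Set.Ioi 0) (x := 0)).tendsto
  filter_upwards [h0.eventually_lt_const (show 0 < η / 2 by positivity), self_mem_nhdsWithin]
    with t ht ht0
  have ht0' : (0 : ℝ) < t := ht0
  have h1 := hY.norm_limit_apply_sub_sub_le hA hT h hzw t
  have h2 : (t : ℝ)⁻¹ • (T t x - x) - y = (t : ℝ)⁻¹ • (T t x - x - (t : ℝ) • y) := by
    rw [smul_sub _ (T t x - x), smul_smul, inv_mul_cancel₀ ht0'.ne', one_smul]
  rw [dist_eq_norm, h2, norm_smul, norm_inv, Real.norm_of_nonneg ht0'.le, inv_mul_lt_iff₀ ht0']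
  nlinarith

theorem isGenerator_limit (hY : IsYosidaSeq A Y) (hA : IsMDissipative A)
    (hT : ∀ (t : ℝ≥0) (x : X),
      Tendsto (fun n => NormedSpace.exp ((t : ℝ) • Y n) x) atTop (𝓝 (T t x))) :
    IsGenerator A T := by
  intro x y
  refine ⟨hY.tendsto_limit_quotient hA hT, fun h => ?_⟩
  -- Maximality: the generator of the limit extends A and is dissipative because the limit is
  -- contractive. Solving (1 - A)p = x - y gives y - q = x - p, and dissipativity then forces x = p.
  obtain ⟨p, q, hpq, e⟩ := hA.exists_sub_smul_eq 1 one_pos (x - y)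
  rw [one_smul] at e
  have h1 := h.sub (hY.tendsto_limit_quotient hA hT hpq)
  have h2 : ⟪x - p, y - q⟫_ℝ ≤ 0 := by
    refine le_of_tendsto ((tendsto_const_nhds (x := x - p)).inner h1)
      (Eventually.of_forall fun t => ?_)
    rw [← smul_sub, real_inner_smul_right]
    refine mul_nonpos_of_nonneg_of_nonpos (inv_nonneg.2 t.coe_nonneg) ?_
    have h3 : T t x - x - (T t p - p) = T t (x - p) - (x - p) := by rw [map_sub]; abel
    have h4 := real_inner_le_norm (x - p) (T t (x - p))
    have h5 := hY.norm_limit_apply_le hA hT t (x - p)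
    rw [h3, inner_sub_right, real_inner_self_eq_norm_sq]
    nlinarith [norm_nonneg (x - p)]
  have h6 : y - q = x - p := by
    have h7 : y - q = p - q + y - p := by abel
    rw [h7, e]; abel
  rw [h6, real_inner_self_eq_norm_sq] at h2
  have h7 : ‖x - p‖ = 0 := by nlinarith [norm_nonneg (x - p)]
  rw [norm_eq_zero] at h7
  rw [h7] at h6
  rw [sub_eq_zero.1 h7, sub_eq_zero.1 h6]
  exact hpq

end IsYosidaSeq

/-! ### A bounded semigroup generated by A is the Yosida limit -/

section Uniqueness

variable {A : X →ₗ.[ℂ] X} {T : ℝ≥0 → X →L[ℂ] X}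

theorem IsGenerator.apply_mem_graph (hg : IsGenerator A T) (hT : IsC0Semigroup T) (s : ℝ≥0)
    (x y : X) (h : (x, y) ∈ A.graph) : (T s x, T s y) ∈ A.graph := by
  rw [hg] at h ⊢
  refine (((T s).continuous.tendsto y).comp h).congr fun t => ?_
  have h1 : T t (T s x) = T s (T t x) := by
    have := congrArg (· x) ((hT.map_add t s).symm.trans ((congrArg T (add_comm t s)).trans
      (hT.map_add s t)))
    exact this
  change T s _ = _
  rw [h1, (T s).map_smul_of_tower, map_sub]

/-- Only the right derivative is available directly from the definition of the generator; it is all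
the mean value inequality needs. -/
theorem IsGenerator.hasDerivWithinAt (hg : IsGenerator A T) (hT : IsC0Semigroup T) {x y : X}
    (h : (x, y) ∈ A.graph) {s : ℝ} (hs : 0 ≤ s) :
    HasDerivWithinAt (fun r : ℝ => T r.toNNReal x) (T s.toNNReal y) (Set.Ici s) s := by
  rw [← hasDerivWithinAt_Ioi_iff_Ici, hasDerivWithinAt_iff_tendsto_slope' (by simp)]
  have h1 := (hg _ _).1 (hg.apply_mem_graph hT s.toNNReal x y h)
  have h2 : Tendsto (fun r : ℝ => (r - s).toNNReal) (𝓝[>] s) (𝓝[>] 0) := by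
    refine tendsto_nhdsWithin_iff.2 ⟨?_, ?_⟩
    · have : Continuous fun r : ℝ => (r - s).toNNReal := by fun_prop
      simpa using (this.continuousWithinAt (s := Set.Ioi s) (x := s)).tendsto
    · filter_upwards [self_mem_nhdsWithin] with r hr
      exact Real.toNNReal_pos.2 (sub_pos.2 hr)
  refine (h1.comp h2).congr' ?_
  filter_upwards [self_mem_nhdsWithin] with r hr
  have hr' : s < r := hr
  have h3 : r.toNNReal = (r - s).toNNReal + s.toNNReal := by
    rw [← Real.toNNReal_add (sub_nonneg.2 hr'.le) hs, sub_add_cancel]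
  have h4 : T r.toNNReal x = T (r - s).toNNReal (T s.toNNReal x) := by
    rw [h3, hT.map_add]; rfl
  rw [slope_def_module, h4, Function.comp_apply, Real.coe_toNNReal _ (sub_nonneg.2 hr'.le)]

/-- On the domain, the orbit T(s)x solves u' = Yₙu up to the defect T(s)(y - Yₙx), which tends to 0
uniformly in s. Density does the rest. -/
theorem IsYosidaSeq.tendsto_exp_of_isGenerator [CompleteSpace X] {Y : ℕ → X →L[ℂ] X}
    (hY : IsYosidaSeq A Y) (hA : IsMDissipative A) (hg : IsGenerator A T) (hT : IsC0Semigroup T)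
    {c : ℝ} (hc : ∀ t, ‖T t‖ ≤ c) (t : ℝ≥0) (x : X) :
    Tendsto (fun n => NormedSpace.exp ((t : ℝ) • Y n) x) atTop (𝓝 (T t x)) := by
  refine tendsto_apply_of_dense
    (fun n x => norm_exp_smul_apply_le (hY.inner_apply_nonpos hA n) t.coe_nonneg x) hA.dense_domain ?_ x
  rintro x ⟨y, hxy⟩
  have key : ∀ n, ‖T t x - NormedSpace.exp ((t : ℝ) • Y n) x‖ ≤ c * ‖y - Y n x‖ * t := by
    intro n
    have hcont : Continuous fun r : ℝ => T r.toNNReal x := (hT.continuous x).comp (by fun_prop)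
    have h := norm_sub_exp_smul_apply_le (hY.inner_apply_nonpos hA n)
      (u := fun r : ℝ => T r.toNNReal x) (u' := fun s => T s.toNNReal y)
      (K := c * ‖y - Y n x‖) t.2 hcont.continuousOn
      (fun s hs => hg.hasDerivWithinAt hT hxy hs) fun s hs => ?_
    · have h0 : T 0 x = x := by rw [hT.map_zero]; rfl
      simpa [h0] using h
    · have hcomm := (hY n).commute hA Nat.one_div_pos_of_nat
        (hg.apply_mem_graph hT s.toNNReal)
      have : Y n (T s.toNNReal x) = T s.toNNReal (Y n x) := DFunLike.congr_fun hcomm.eq x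
      rw [this, ← map_sub]
      exact (ContinuousLinearMap.le_opNorm _ _).trans
        (mul_le_mul_of_nonneg_right (hc _) (norm_nonneg _))
  rw [tendsto_iff_norm_sub_tendsto_zero]
  have h0 : Tendsto (fun n => c * ‖y - Y n x‖ * t) atTop (𝓝 0) := by
    have := (((hY.tendsto_apply hA hxy).const_sub y).norm.const_mul c).mul_const (t : ℝ)
    simpa using this
  exact squeeze_zero (fun n => norm_nonneg _) (fun n => by rw [norm_sub_rev]; exact key n) h0

end Uniqueness

/-! ### Transfer of exponential stability by energy comparison -/

section Stability

/-- With n = ⌊t/τ⌋ the norm at time t is at most qⁿ, and n ≥ t/τ - 1; the lost unit is paid for by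
the constant 1/q. -/
theorem generatesExpStable_of_norm_lt_one {A : X →ₗ.[ℂ] X} {T : ℝ≥0 → X →L[ℂ] X}
    (hT : IsC0Semigroup T) (hg : IsGenerator A T) (hle : ∀ t x, ‖T t x‖ ≤ ‖x‖) {τ : ℝ≥0} {q : ℝ}
    (hτ : 0 < τ) (hq0 : 0 < q) (hq1 : q < 1) (hq : ‖T τ‖ ≤ q) : GeneratesExpStable A := by
  have hτ' : (0 : ℝ) < τ := hτ
  have hlog : Real.log q < 0 := Real.log_neg hq0 hq1
  refine ⟨T, hT, hg, q⁻¹, -Real.log q / τ, inv_pos.2 hq0, div_pos (neg_pos.2 hlog) hτ', fun t => ?_⟩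
  have hpow : ∀ n : ℕ, ‖T (n * τ)‖ ≤ q ^ n := by
    intro n
    induction n with
    | zero =>
      rw [Nat.cast_zero, zero_mul, hT.map_zero, pow_zero]
      exact ContinuousLinearMap.norm_id_le
    | succ n ih =>
      rw [Nat.cast_succ, add_mul, one_mul, hT.map_add, pow_succ]
      exact (norm_mul_le _ _).trans (mul_le_mul ih hq (norm_nonneg _) (by positivity))
  set n := ⌊t / τ⌋₊ with hn
  have h1 : (n : ℝ≥0) * τ ≤ t := by
    rw [← le_div_iff₀ hτ]; exact Nat.floor_le (by positivity)
  obtain ⟨r, hr⟩ := exists_add_of_le h1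
  have h2 : ‖T t‖ ≤ q ^ n := by
    have h3 : ‖T r‖ ≤ 1 := ContinuousLinearMap.opNorm_le_bound _ zero_le_one (by simpa using hle r)
    rw [hr, hT.map_add]
    calc _ ≤ ‖T (n * τ)‖ * ‖T r‖ := norm_mul_le _ _
      _ ≤ q ^ n * 1 := mul_le_mul (hpow n) h3 (norm_nonneg _) (by positivity)
      _ = _ := mul_one _
  have h4 : (t : ℝ) / τ ≤ n + 1 := by
    have := (Nat.lt_floor_add_one (t / τ)).le
    rw [← hn] at this
    exact_mod_cast this
  refine h2.trans ?_
  have h5 : q⁻¹ * Real.exp (-(-Real.log q / τ) * t) = Real.exp (Real.log q * (t / τ - 1)) := by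
    nth_rewrite 1 [← Real.exp_log hq0]
    rw [← Real.exp_neg, ← Real.exp_add]
    congr 1; field_simp; ring
  have h6 : q ^ n = Real.exp (Real.log q * n) := by
    rw [mul_comm, Real.exp_nat_mul, Real.exp_log hq0]
  rw [h5, h6, Real.exp_le_exp]
  nlinarith

theorem GeneratesExpStable.exists_norm_le_half {A : X →ₗ.[ℂ] X} (h : GeneratesExpStable A) :
    ∃ T : ℝ≥0 → X →L[ℂ] X, IsC0Semigroup T ∧ IsGenerator A T ∧
      (∃ c, ∀ t, ‖T t‖ ≤ c) ∧ ∃ τ, 0 < τ ∧ ‖T τ‖ ≤ 1 / 2 := by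
  obtain ⟨T, hT, hg, c, β, hc, hβ, hb⟩ := h
  refine ⟨T, hT, hg, ⟨c, fun t => (hb t).trans ?_⟩, ?_⟩
  · have : Real.exp (-β * t) ≤ 1 := Real.exp_le_one_iff.2 (by nlinarith [t.coe_nonneg, mul_nonneg hβ.le t.coe_nonneg])
    nlinarith
  · have h1 : Tendsto (fun t : ℝ => c * Real.exp (-β * t)) atTop (𝓝 0) := by
      have h2 : Tendsto (fun t : ℝ => -β * t) atTop atBot :=
        tendsto_id.const_mul_atTop_of_neg (neg_neg_of_pos hβ)
      simpa using (Real.tendsto_exp_atBot.comp h2).const_mul c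
    obtain ⟨s, hs, hs0⟩ := ((h1.eventually_lt_const (show (0 : ℝ) < 1 / 2 by norm_num)).and
      (eventually_gt_atTop 0)).exists
    refine ⟨⟨s, hs0.le⟩, hs0, (hb _).trans ?_⟩
    exact hs.le

/-- The energy comparison between two damped evolutions with the same dissipation rate `h`. -/
theorem norm_exp_sub_sq_add_le [CompleteSpace X] {A₁ A₂ : X →ₗ.[ℂ] X} {ε : ℝ} (hε : 0 < ε)
    {Y₁ Y₂ : X →L[ℂ] X} (hY₁ : IsYosida A₁ ε Y₁) (hY₂ : IsYosida A₂ ε Y₂) {h : X → ℝ} {E : X → X}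
    {k : ℝ} (hk : 0 ≤ k) (hE : ∀ x y, (x, y) ∈ A₂.graph → (x + E y, y) ∈ A₁.graph)
    (hd₁ : ∀ x y, (x, y) ∈ A₁.graph → ⟪x, y⟫_ℝ ≤ -h y)
    (hd₂ : ∀ x y, (x, y) ∈ A₂.graph → ⟪x, y⟫_ℝ ≤ -h y)
    (hb : ∀ y z, ⟪E y, z⟫_ℝ ≤ h z + k * h y) {t : ℝ} (ht : 0 ≤ t) (x : X) :
    ‖NormedSpace.exp (t • Y₁) x - NormedSpace.exp (t • Y₂) x‖ ^ 2 +
      k * ‖NormedSpace.exp (t • Y₂) x‖ ^ 2 ≤ k * ‖x‖ ^ 2 := by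
  have hanti : Antitone fun s : ℝ =>
      ‖NormedSpace.exp (s • Y₁) x - NormedSpace.exp (s • Y₂) x‖ ^ 2 +
        k * ‖NormedSpace.exp (s • Y₂) x‖ ^ 2 := by
    refine antitone_of_hasDerivAt_nonpos (fun s =>
      (((hasDerivAt_exp_smul_apply Y₁ x s).sub (hasDerivAt_exp_smul_apply Y₂ x s)).norm_sq).add
        ((hasDerivAt_exp_smul_apply Y₂ x s).norm_sq.const_mul k)) fun s => ?_
    simp only [Pi.sub_apply, Pi.zero_apply]
    set u := NormedSpace.exp (s • Y₁) x
    set v := NormedSpace.exp (s • Y₂) x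
    have h1 := hd₂ _ _ (hY₂ v)
    -- `E` corrects the graph point of A₂ into one of A₁, so the difference of the two orbits can be
    -- tested with the dissipation of A₁.
    have h2 := hd₁ _ _ (A₁.graph.sub_mem (hY₁ u) (hE _ _ (hY₂ v)))
    have h3 := hb (Y₂ v) (Y₁ u - Y₂ v)
    have h4 : u + ε • Y₁ u - (v + ε • Y₂ v + E (Y₂ v)) =
        (u - v) + ε • (Y₁ u - Y₂ v) - E (Y₂ v) := by rw [smul_sub]; abel
    rw [inner_add_left, real_inner_smul_left, real_inner_self_eq_norm_sq] at h1
    simp only [h4] at h2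
    rw [inner_sub_left, inner_add_left, real_inner_smul_left, real_inner_self_eq_norm_sq] at h2
    have h5 : 0 ≤ ε * ‖Y₂ v‖ ^ 2 := by positivity
    have h6 : 0 ≤ ε * ‖Y₁ u - Y₂ v‖ ^ 2 := by positivity
    -- The Yosida terms `h5` and `h6` only strengthen the dissipation. The gain -k h(Y₂v) from the
    -- second orbit cancels the k h(Y₂v) coming from `hb`.
    nlinarith [mul_le_mul_of_nonneg_left h1 hk, mul_nonneg hk h5]
  simpa using hanti ht

theorem GeneratesExpStable.of_comparison [CompleteSpace X] {A₁ A₂ : X →ₗ.[ℂ] X}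
    (hA₁ : IsMDissipative A₁) (hA₂ : IsMDissipative A₂) {h : X → ℝ} {E : X → X} {k : ℝ}
    (hk : 1 ≤ k) (hE : ∀ x y, (x, y) ∈ A₂.graph → (x + E y, y) ∈ A₁.graph)
    (hd₁ : ∀ x y, (x, y) ∈ A₁.graph → ⟪x, y⟫_ℝ ≤ -h y)
    (hd₂ : ∀ x y, (x, y) ∈ A₂.graph → ⟪x, y⟫_ℝ ≤ -h y)
    (hb : ∀ y z, ⟪E y, z⟫_ℝ ≤ h z + k * h y) (hs : GeneratesExpStable A₁) :
    GeneratesExpStable A₂ := by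
  have hk0 : 0 < k := one_pos.trans_le hk
  obtain ⟨T₁, hT₁, hg₁, ⟨c, hc⟩, τ, hτ, hhalf⟩ := hs.exists_norm_le_half
  obtain ⟨Y₁, hY₁⟩ := hA₁.exists_isYosidaSeq
  obtain ⟨Y₂, hY₂⟩ := hA₂.exists_isYosidaSeq
  obtain ⟨T₂, hT₂⟩ := hY₂.exists_tendsto_exp hA₂
  have hlim : ∀ x, ‖T₁ τ x - T₂ τ x‖ ^ 2 + k * ‖T₂ τ x‖ ^ 2 ≤ k * ‖x‖ ^ 2 := fun x =>
    le_of_tendsto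
      ((((hY₁.tendsto_exp_of_isGenerator hA₁ hg₁ hT₁ hc τ x).sub (hT₂ τ x)).norm.pow 2).add
        (((hT₂ τ x).norm.pow 2).const_mul k))
      (Filter.Eventually.of_forall fun n => norm_exp_sub_sq_add_le Nat.one_div_pos_of_nat (hY₁ n)
        (hY₂ n) hk0.le hE hd₁ hd₂ hb τ.coe_nonneg x)
  -- As k ≥ 1, the squared contraction factor 1 - 1/(16k) is at least 15/16, which exceeds the
  -- (3/4)² needed in the first case below.
  have hk1 : 1 / (16 * k) ≤ 1 / 16 := by
    rw [div_le_div_iff₀ (by positivity) (by positivity)]; linarith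
  have hk2 : 0 < 1 / (16 * k) := by positivity
  have hk3 : 1 / (16 * k) * k = 1 / 16 := by field_simp
  have hq : 0 < 1 - 1 / (16 * k) := by linarith
  refine generatesExpStable_of_norm_lt_one (hY₂.isC0Semigroup_limit hA₂ hT₂)
    (hY₂.isGenerator_limit hA₂ hT₂) (hY₂.norm_limit_apply_le hA₂ hT₂) hτ (Real.sqrt_pos.2 hq)
    ((Real.sqrt_lt' one_pos).2 (by linarith)) ?_
  refine ContinuousLinearMap.opNorm_le_bound _ (Real.sqrt_nonneg _) fun x => ?_
  refine le_of_sq_le_sq ?_ (by positivity)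
  rw [mul_pow, Real.sq_sqrt hq.le]
  have h1 : ‖T₁ τ x‖ ≤ 1 / 2 * ‖x‖ :=
    ((T₁ τ).le_opNorm x).trans (mul_le_mul_of_nonneg_right hhalf (norm_nonneg x))
  have h2 : ‖T₂ τ x‖ - ‖T₁ τ x‖ ≤ ‖T₁ τ x - T₂ τ x‖ := by
    rw [norm_sub_rev]; exact norm_sub_norm_le _ _
  have h3 := hlim x
  have hx := norm_nonneg x
  -- Either the second orbit has already shrunk by 3/4, or it is at distance at least ‖x‖/4 from the
  -- first, and the comparison costs it ‖x‖²/(16k).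
  rcases le_total ‖T₂ τ x‖ (3 / 4 * ‖x‖) with h4 | h4
  · nlinarith [norm_nonneg (T₂ τ x), sq_nonneg ‖x‖]
  · have h5 : (1 / 4 * ‖x‖) ^ 2 ≤ ‖T₁ τ x - T₂ τ x‖ ^ 2 :=
      pow_le_pow_left₀ (by positivity) (by linarith) 2
    refine le_of_mul_le_mul_left ?_ hk0
    have h6 : k * ((1 - 1 / (16 * k)) * ‖x‖ ^ 2) = k * ‖x‖ ^ 2 - 1 / (16 * k) * k * ‖x‖ ^ 2 := by
      ring
    rw [h6, hk3]
    nlinarith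

end Stability

end Generation

/-! ### Sectorial forms -/

section SectorBound

variable {Y : Type*} [NormedAddCommGroup Y] [InnerProductSpace ℂ Y]

/-- `C` is accretive and `|Im (C y, y)| ≤ k Re (C y, y)`. -/
def HasSectorBound (C : Y →L[ℂ] Y) (k : ℝ) : Prop :=
  ∀ y, 0 ≤ (⟪y, C y⟫_ℂ).re ∧ |(⟪y, C y⟫_ℂ).im| ≤ k * (⟪y, C y⟫_ℂ).re

theorem IsSectorial.exists_hasSectorBound {C : Y →L[ℂ] Y} (hC : IsSectorial C) :
    ∃ k, HasSectorBound C k := by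
  obtain ⟨θ, hθ, h⟩ := hC
  have hθ0 : 0 ≤ θ := (abs_nonneg _).trans (h 0)
  have hcos : 0 < Real.cos θ := Real.cos_pos_of_mem_Ioo ⟨by linarith [Real.pi_pos], hθ⟩
  refine ⟨(Real.cos θ)⁻¹, fun y => ?_⟩
  set z := ⟪y, C y⟫_ℂ
  have h1 : Real.cos θ ≤ Real.cos z.arg := by
    rw [← Real.cos_abs z.arg]
    exact Real.cos_le_cos_of_nonneg_of_le_pi (abs_nonneg _) (by linarith [Real.pi_pos]) (h y)
  have h2 : ‖z‖ * Real.cos θ ≤ z.re := by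
    rw [← Complex.norm_mul_cos_arg z]
    exact mul_le_mul_of_nonneg_left h1 (norm_nonneg z)
  refine ⟨(mul_nonneg (norm_nonneg z) hcos.le).trans h2, (Complex.abs_im_le_norm z).trans ?_⟩
  rwa [inv_mul_eq_div, le_div_iff₀ hcos]

theorem hasSectorBound_hermitianPart [CompleteSpace Y] {C : Y →L[ℂ] Y} {k : ℝ}
    (hC : HasSectorBound C k) :
    HasSectorBound ((1 / 2 : ℂ) • (ContinuousLinearMap.adjoint C + C)) 0 ∧
      ∀ y, (⟪y, ((1 / 2 : ℂ) • (ContinuousLinearMap.adjoint C + C)) y⟫_ℂ).re =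
        (⟪y, C y⟫_ℂ).re := by
  have h : ∀ y, ⟪y, ((1 / 2 : ℂ) • (ContinuousLinearMap.adjoint C + C)) y⟫_ℂ =
      ((⟪y, C y⟫_ℂ).re : ℂ) := by
    intro y
    rw [smul_apply, add_apply, inner_smul_right, inner_add_right,
      ContinuousLinearMap.adjoint_inner_right, ← inner_conj_symm (C y) y, add_comm,
      Complex.add_conj]
    push_cast; ring
  refine ⟨fun y => ?_, fun y => ?_⟩
  · rw [h, Complex.ofReal_re, Complex.ofReal_im]
    simpa using (hC y).1
  · rw [h, Complex.ofReal_re]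

theorem eq_zero_of_forall_abs_le {a b c : ℝ} (h : ∀ t : ℝ, |t * a + t ^ 2 * b| ≤ c * t ^ 2) :
    a = 0 := by
  by_contra ha
  have hd : 0 < |b| + |c| + 1 := by positivity
  -- At t = a/d the linear term is a²/d, and d > |b| + |c| makes it exceed both quadratic terms.
  have h1 := h (a / (|b| + |c| + 1))
  set d := |b| + |c| + 1 with hdd
  have h2 := (abs_le.1 h1).2
  have h3 : a / d * a + (a / d) ^ 2 * b - c * (a / d) ^ 2 = a ^ 2 / d ^ 2 * (d + b - c) := by
    field_simp
  have h4 : 0 < a ^ 2 / d ^ 2 * (d + b - c) := by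
    have : 0 < d + b - c := by linarith [neg_abs_le b, le_abs_self c]
    positivity
  linarith

theorem inner_add_smul_expand (C : Y →L[ℂ] Y) (x y : Y) (c : ℂ) :
    ⟪x + c • y, C (x + c • y)⟫_ℂ = ⟪x, C x⟫_ℂ + (c * ⟪x, C y⟫_ℂ + (starRingEnd ℂ) c * ⟪y, C x⟫_ℂ) +
      (starRingEnd ℂ) c * c * ⟪y, C y⟫_ℂ := by
  simp only [map_add, map_smul, inner_add_left, inner_add_right, inner_smul_left, inner_smul_right]
  ring

/-- The real part of the form is minimal at `x`, so its first variation there vanishes; the sector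
bound then makes the imaginary part quadratically small too, so its first variation also vanishes.
-/
theorem HasSectorBound.eq_zero {C : Y →L[ℂ] Y} {k : ℝ} (hC : HasSectorBound C k) {x : Y}
    (hx : (⟪x, C x⟫_ℂ).re = 0) : C x = 0 ∧ ∀ y, ⟪x, C y⟫_ℂ = 0 := by
  have him : (⟪x, C x⟫_ℂ).im = 0 := by
    have := (hC x).2
    rw [hx, mul_zero] at this
    exact abs_nonpos_iff.1 this
  have hsum : ∀ y, ⟪x, C y⟫_ℂ + ⟪y, C x⟫_ℂ = 0 := by
    intro y
    have hre : ∀ t : ℝ, (⟪x + (t : ℂ) • y, C (x + (t : ℂ) • y)⟫_ℂ).re =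
        t * (⟪x, C y⟫_ℂ + ⟪y, C x⟫_ℂ).re + t ^ 2 * (⟪y, C y⟫_ℂ).re := fun t => by
      rw [inner_add_smul_expand]; simp [hx]; ring
    have hi : ∀ t : ℝ, (⟪x + (t : ℂ) • y, C (x + (t : ℂ) • y)⟫_ℂ).im =
        t * (⟪x, C y⟫_ℂ + ⟪y, C x⟫_ℂ).im + t ^ 2 * (⟪y, C y⟫_ℂ).im := fun t => by
      rw [inner_add_smul_expand]; simp [him]; ring
    set a := (⟪x, C y⟫_ℂ + ⟪y, C x⟫_ℂ).re
    have ha : a = 0 := by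
      by_contra ha
      have hpos : ∀ t : ℝ, 0 ≤ t * a + t ^ 2 * (⟪y, C y⟫_ℂ).re := fun t => by
        rw [← hre]; exact (hC _).1
      refine ha (eq_zero_of_forall_abs_le (b := 0) (c := (⟪y, C y⟫_ℂ).re) fun t => ?_)
      have h1 := hpos t
      have h2 := hpos (-t)
      rw [abs_le]
      constructor <;> nlinarith
    refine Complex.ext ha (eq_zero_of_forall_abs_le (b := (⟪y, C y⟫_ℂ).im)
      (c := k * (⟪y, C y⟫_ℂ).re) fun t => ?_)
    rw [← hi]
    refine (hC _).2.trans_eq ?_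
    rw [hre, ha]; ring
  have hdiff : ∀ y, ⟪x, C y⟫_ℂ - ⟪y, C x⟫_ℂ = 0 := by
    intro y
    -- Replacing y by iy turns the sum of the two sesquilinear terms into their difference, so each
    -- vanishes.
    have h := hsum (Complex.I • y)
    rw [map_smul, inner_smul_right, inner_smul_left, Complex.conj_I, neg_mul, ← sub_eq_add_neg,
      ← mul_sub] at h
    exact (mul_eq_zero.1 h).resolve_left Complex.I_ne_zero
  have h1 : ∀ y, ⟪x, C y⟫_ℂ = 0 := fun y => by
    linear_combination (1 / 2 : ℂ) * hsum y + (1 / 2 : ℂ) * hdiff y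
  refine ⟨ext_inner_left ℂ fun y => ?_, h1⟩
  rw [inner_zero_right]
  linear_combination h1 y - hdiff y

/-- The difference of two sectorial operators with the same real part is bounded relative to that
real part. -/
theorem HasSectorBound.exists_re_inner_sub_le {C₁ C₂ : Y →L[ℂ] Y} {k₁ k₂ : ℝ}
    (h₁ : HasSectorBound C₁ k₁) (h₂ : HasSectorBound C₂ k₂)
    (he : ∀ y, (⟪y, C₁ y⟫_ℂ).re = (⟪y, C₂ y⟫_ℂ).re) :
    ∃ k, 1 ≤ k ∧ ∀ y z, (⟪(C₂ - C₁) y, z⟫_ℂ).re ≤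
      (⟪z, C₁ z⟫_ℂ).re + k * (⟪y, C₁ y⟫_ℂ).re := by
  set K := |k₁| + |k₂| + 1 with hK
  have hK1 : 1 ≤ K := by linarith [abs_nonneg k₁, abs_nonneg k₂]
  set D := C₂ - C₁ with hD
  set h : Y → ℝ := fun y => (⟪y, C₁ y⟫_ℂ).re with hh
  have h0 : ∀ y, 0 ≤ h y := fun y => (h₁ y).1
  have hre : ∀ y, (⟪y, D y⟫_ℂ).re = 0 := fun y => by
    rw [hD, sub_apply, inner_sub_right, Complex.sub_re, he, sub_self]
  have him : ∀ y, |(⟪y, D y⟫_ℂ).im| ≤ K * h y := fun y => by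
    rw [hD, sub_apply, inner_sub_right, Complex.sub_im]
    have e1 := (h₁ y).2
    have e2 := (h₂ y).2
    rw [← he] at e2
    have e3 : k₁ * h y ≤ |k₁| * h y := mul_le_mul_of_nonneg_right (le_abs_self _) (h0 y)
    have e4 : k₂ * h y ≤ |k₂| * h y := mul_le_mul_of_nonneg_right (le_abs_self _) (h0 y)
    have e5 := abs_sub (⟪y, C₂ y⟫_ℂ).im (⟪y, C₁ y⟫_ℂ).im
    have e6 := h0 y
    rw [hK]
    simp only [hh] at *
    linarith
  have hskew : ∀ y z, (⟪y, D z⟫_ℂ).re = -(⟪z, D y⟫_ℂ).re := fun y z => by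
    have e := hre (y + z)
    rw [map_add, inner_add_left, inner_add_right, inner_add_right] at e
    simp only [Complex.add_re, hre] at e
    linarith
  have hpar : ∀ y z, h (z + Complex.I • y) + h (z + (-Complex.I) • y) = 2 * (h z + h y) :=
    fun y z => by
      simp only [hh, inner_add_smul_expand]
      simp
      ring
  -- Polarization: since D has no real part, the imaginary parts of its form at z ± iy differ by 4
  -- Re(z, Dy), while the parallelogram law controls the sum of the bounds.
  have hpol : ∀ y z, (⟪z, D y⟫_ℂ).re ≤ K / 2 * (h z + h y) := fun y z => by
    have e1 := (le_abs_self _).trans (him (z + Complex.I • y))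
    have e2 := (neg_le_abs _).trans (him (z + (-Complex.I) • y))
    rw [inner_add_smul_expand] at e1 e2
    simp at e1 e2
    have e3 := hskew y z
    have e4 := hpar y z
    rw [neg_smul] at e4
    nlinarith
  have hK0 : (K : ℂ) ≠ 0 := by exact_mod_cast (zero_lt_one.trans_le hK1).ne'
  have hscale : ∀ (r : ℝ) y, h ((r : ℂ) • y) = r ^ 2 * h y := fun r y => by
    simp only [hh, map_smul, inner_smul_left, inner_smul_right, Complex.conj_ofReal, ← mul_assoc]
    rw [← Complex.ofReal_mul, Complex.re_ofReal_mul, sq]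
  refine ⟨K ^ 3, one_le_pow₀ hK1, fun y z => ?_⟩
  -- The scaling z ↦ z/K, y ↦ Ky keeps the pairing and lowers the coefficient of h(z) to 1/(2K) ≤ 1,
  -- at the price of K³/2 on h(y).
  have e := hpol ((K : ℂ) • y) (((K⁻¹ : ℝ) : ℂ) • z)
  rw [hscale, hscale, map_smul, inner_smul_left, inner_smul_right, Complex.conj_ofReal,
    Complex.ofReal_inv, inv_mul_cancel_left₀ hK0] at e
  have e1 : (⟪D y, z⟫_ℂ).re = (⟪z, D y⟫_ℂ).re := by
    rw [← inner_conj_symm, Complex.conj_re]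
  rw [e1]
  refine e.trans ?_
  have e2 : K / 2 * (K⁻¹ ^ 2 * h z + K ^ 2 * h y) = K⁻¹ / 2 * h z + K ^ 3 / 2 * h y := by
    field_simp
  have e3 : K⁻¹ ≤ 1 := inv_le_one_of_one_le₀ hK1
  have e4 : 0 ≤ K ^ 3 := by positivity
  rw [e2]
  have := h0 z
  have := mul_nonneg e4 (h0 y)
  change _ ≤ h z + K ^ 3 * h y
  nlinarith

end SectorBound

/-! ### Null-space, part and inverse in terms of graphs -/

section Graphs

variable {H : Type*} [NormedAddCommGroup H] [InnerProductSpace ℂ H]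

theorem mem_nullSpace_iff {T : H →ₗ.[ℂ] H} {x : H} : x ∈ nullSpace T ↔ (x, 0) ∈ T.graph := by
  simp only [nullSpace, Submodule.mem_map, LinearMap.mem_ker, LinearPMap.mem_graph_iff]
  constructor
  · rintro ⟨y, hy, rfl⟩
    exact ⟨y, rfl, hy⟩
  · rintro ⟨y, rfl, hy⟩
    exact ⟨y, hy, rfl⟩

theorem mem_graph_partIn_iff {T : H →ₗ.[ℂ] H} {X : Submodule ℂ H} {x y : X} :
    (x, y) ∈ (partIn T X).graph ↔ ((x : H), (y : H)) ∈ T.graph := by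
  simp only [LinearPMap.mem_graph_iff]
  constructor
  · rintro ⟨z, rfl, rfl⟩
    exact ⟨⟨((z : X) : H), z.2.1⟩, rfl, rfl⟩
  · rintro ⟨z, hz, hzy⟩
    have h : (x : H) ∈ T.domain := hz ▸ z.2
    have h1 : z = ⟨x, h⟩ := Subtype.ext hz
    refine ⟨⟨x, h, ?_⟩, rfl, Subtype.ext ?_⟩
    · rw [← h1, hzy]; exact y.2
    · change T ⟨x, h⟩ = y
      rw [← h1, hzy]

/-- A null vector of the part lies in the null-space and in its orthogonal complement, so the part
is injective and its inverse has the flipped graph. -/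
theorem mem_graph_inverse_partIn_iff {T : H →ₗ.[ℂ] H} {X : Submodule ℂ H}
    (hX : X = (nullSpace T)ᗮ) {x y : X} :
    (x, y) ∈ (partIn T X).inverse.graph ↔ ((y : H), (x : H)) ∈ T.graph := by
  have hker : (partIn T X).toFun.ker = ⊥ := by
    rw [LinearMap.ker_eq_bot']
    intro z hz
    have h1 : (((z : X) : H), (0 : H)) ∈ T.graph :=
      mem_graph_partIn_iff (y := 0).1 (LinearPMap.mem_graph_iff _ |>.2 ⟨z, rfl, hz⟩)
    have h2 : ((z : X) : H) ∈ (nullSpace T)ᗮ := hX ▸ (z : X).2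
    have h3 := Submodule.inner_right_of_mem_orthogonal (mem_nullSpace_iff.2 h1) h2
    exact Subtype.ext (Subtype.ext (inner_self_eq_zero.1 h3))
  rw [LinearPMap.inverse_graph hker, ← mem_graph_partIn_iff (X := X)]
  simp

end Graphs

/-! ### The phase space operator and the comparison of two dampings -/

section BlockOp

variable {Y : Type*} [NormedAddCommGroup Y] [InnerProductSpace ℂ Y]

theorem mem_graph_blockOp_iff {S : Y →ₗ.[ℂ] Y} {C : Y →L[ℂ] Y} {z w : WithLp 2 (Y × Y)} :
    (z, w) ∈ (blockOp S C).graph ↔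
      (z.fst, w.snd) ∈ S.graph ∧ (z.snd, -C z.fst - w.fst) ∈ S.graph := by
  constructor
  · intro h
    obtain ⟨u, rfl, rfl⟩ := (LinearPMap.mem_graph_iff _).1 h
    refine ⟨(LinearPMap.mem_graph_iff _).2 ⟨⟨_, u.2.1⟩, rfl, rfl⟩,
      (LinearPMap.mem_graph_iff _).2 ⟨⟨_, u.2.2⟩, rfl, ?_⟩⟩
    change _ = -C (u : WithLp 2 (Y × Y)).fst - (-C (u : WithLp 2 (Y × Y)).fst - S ⟨_, u.2.2⟩)
    abel
  · rintro ⟨h1, h2⟩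
    obtain ⟨⟨_, hu⟩, rfl, hu'⟩ := (LinearPMap.mem_graph_iff _).1 h1
    obtain ⟨⟨_, hv⟩, rfl, hv'⟩ := (LinearPMap.mem_graph_iff _).1 h2
    refine (LinearPMap.mem_graph_iff _).2 ⟨⟨z, hu, hv⟩, rfl, ?_⟩
    change S ⟨z.fst, hu⟩ = w.snd at hu'
    change S ⟨z.snd, hv⟩ = -C z.fst - w.fst at hv'
    change WithLp.toLp 2 (-C z.fst - S ⟨z.snd, hv⟩, S ⟨z.fst, hu⟩) = w
    rw [hu', hv', sub_sub_cancel]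
    rfl

variable [CompleteSpace Y] {S : Y →ₗ.[ℂ] Y} {C : Y →L[ℂ] Y} {k : ℝ}

theorem isClosed_graph_blockOp (hS : IsPosSelfAdjoint S) :
    IsClosed ((blockOp S C).graph : Set (WithLp 2 (Y × Y) × WithLp 2 (Y × Y))) := by
  have hSc : IsClosed (S.graph : Set (Y × Y)) := hS.isSelfAdjoint.isClosed
  have : ((blockOp S C).graph : Set (WithLp 2 (Y × Y) × WithLp 2 (Y × Y))) =
      (fun p => (p.1.fst, p.2.snd)) ⁻¹' (S.graph : Set (Y × Y)) ∩
        (fun p => (p.1.snd, -C p.1.fst - p.2.fst)) ⁻¹' (S.graph : Set (Y × Y)) := by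
    ext ⟨z, w⟩
    exact mem_graph_blockOp_iff
  rw [this]
  refine (hSc.preimage ?_).inter (hSc.preimage ?_) <;> fun_prop

/-- The off-diagonal entries are skew because S is symmetric; only the damping survives in the real
part. -/
theorem re_inner_graph_blockOp (hS : IsPosSelfAdjoint S) {z w : WithLp 2 (Y × Y)}
    (h : (z, w) ∈ (blockOp S C).graph) : (⟪w, z⟫_ℂ).re = -(⟪z.fst, C z.fst⟫_ℂ).re := by
  obtain ⟨h1, h2⟩ := mem_graph_blockOp_iff.1 h
  have h3 := inner_graph_symm hS h1 h2
  have h4 : (⟪w.fst, z.fst⟫_ℂ).re = (⟪z.fst, w.fst⟫_ℂ).re := inner_re_symm (𝕜 := ℂ) _ _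
  rw [WithLp.prod_inner_apply]
  change (⟪w.fst, z.fst⟫_ℂ + ⟪w.snd, z.snd⟫_ℂ).re = _
  rw [h3, Complex.add_re, h4, inner_sub_right, inner_neg_right]
  simp

theorem mem_nullSpace_blockOp_iff (hS : IsPosSelfAdjoint S) (hC : HasSectorBound C k)
    {z : WithLp 2 (Y × Y)} : z ∈ nullSpace (blockOp S C) ↔
      (z.fst, (0 : Y)) ∈ S.graph ∧ (⟪z.fst, C z.fst⟫_ℂ).re = 0 ∧ (z.snd, (0 : Y)) ∈ S.graph := by
  rw [mem_nullSpace_iff]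
  constructor
  · intro h
    have hre : (⟪z.fst, C z.fst⟫_ℂ).re = 0 := by
      have := re_inner_graph_blockOp hS h
      rw [inner_zero_left, Complex.zero_re] at this
      linarith
    obtain ⟨h1, h2⟩ := mem_graph_blockOp_iff.1 h
    refine ⟨h1, hre, ?_⟩
    simpa [(hC.eq_zero hre).1] using h2
  · rintro ⟨h1, h2, h3⟩
    refine mem_graph_blockOp_iff.2 ⟨h1, ?_⟩
    simpa [(hC.eq_zero h2).1] using h3

/-- This puts both systems in one physical space, without which their semigroups could not be
compared. -/
theorem nullSpace_blockOp_congr (hS : IsPosSelfAdjoint S) (hC : HasSectorBound C k)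
    {C' : Y →L[ℂ] Y} {k' : ℝ} (hC' : HasSectorBound C' k')
    (he : ∀ y, (⟪y, C y⟫_ℂ).re = (⟪y, C' y⟫_ℂ).re) :
    nullSpace (blockOp S C) = nullSpace (blockOp S C') := by
  ext z
  rw [mem_nullSpace_blockOp_iff hS hC, mem_nullSpace_blockOp_iff hS hC', he]

theorem isClosed_nullSpace_blockOp (hS : IsPosSelfAdjoint S) :
    IsClosed (nullSpace (blockOp S C) : Set (WithLp 2 (Y × Y))) := by
  have : (nullSpace (blockOp S C) : Set (WithLp 2 (Y × Y))) =
      (fun z => (z, 0)) ⁻¹' ((blockOp S C).graph : Set (WithLp 2 (Y × Y) × WithLp 2 (Y × Y))) := by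
    ext z
    exact mem_nullSpace_iff
  rw [this]
  exact (isClosed_graph_blockOp hS).preimage (by fun_prop)

/-- A null vector n has S n₁ = S n₂ = 0 and C*n₁ = 0, so it is annihilated by the adjoint. Hence the
operator maps into 𝒳 automatically. -/
theorem mem_orthogonal_nullSpace_of_graph (hS : IsPosSelfAdjoint S) (hC : HasSectorBound C k)
    {z w : WithLp 2 (Y × Y)} (h : (z, w) ∈ (blockOp S C).graph) :
    w ∈ (nullSpace (blockOp S C))ᗮ := by
  rw [Submodule.mem_orthogonal]
  intro n hn
  obtain ⟨h1, h2, h3⟩ := (mem_nullSpace_blockOp_iff hS hC).1 hn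
  obtain ⟨h4, h5⟩ := mem_graph_blockOp_iff.1 h
  have h6 := inner_graph_symm hS h1 h5
  have h7 := inner_graph_symm hS h3 h4
  have h8 := (hC.eq_zero h2).2 z.fst
  rw [inner_zero_left] at h6 h7
  rw [inner_sub_right, inner_neg_right, h8, neg_zero, zero_sub] at h6
  rw [WithLp.prod_inner_apply]
  change ⟪n.fst, w.fst⟫_ℂ + ⟪n.snd, w.snd⟫_ℂ = 0
  rw [← h7, add_zero]
  exact neg_eq_zero.1 h6.symm

/-- Vectors orthogonal to the range of `𝒜⁺ - ε` are described by the adjoint block operator. -/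
theorem mem_graph_of_orthogonal_range (hS : IsPosSelfAdjoint S) (ε : ℝ) {w : WithLp 2 (Y × Y)}
    (h : ∀ z v, (z, v) ∈ (blockOp S C).graph → ⟪w, v - (ε : ℂ) • z⟫_ℂ = 0) :
    (w.fst, -((ε : ℂ) • w.snd)) ∈ S.graph ∧
      (w.snd, ContinuousLinearMap.adjoint C w.fst + (ε : ℂ) • w.fst) ∈ S.graph := by
  constructor
  · refine mem_graph_of_adjoint hS.isSelfAdjoint fun x => ?_
    -- Test vectors supported in a single component decouple the two equations.
    have hg : (WithLp.toLp 2 ((0 : Y), (x : Y)), WithLp.toLp 2 (-S x, (0 : Y))) ∈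
        (blockOp S C).graph := mem_graph_blockOp_iff.2
      ⟨S.graph.zero_mem, by simp⟩
    have h1 := h _ _ hg
    rw [WithLp.prod_inner_apply] at h1
    change ⟪w.fst, -S x - (ε : ℂ) • (0 : Y)⟫_ℂ + ⟪w.snd, (0 : Y) - (ε : ℂ) • (x : Y)⟫_ℂ = 0 at h1
    rw [smul_zero, sub_zero, zero_sub, inner_neg_right, inner_neg_right, inner_smul_right] at h1
    rw [inner_neg_left, inner_smul_left, Complex.conj_ofReal]
    linear_combination h1
  · refine mem_graph_of_adjoint hS.isSelfAdjoint fun x => ?_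
    have hg : (WithLp.toLp 2 ((x : Y), (0 : Y)), WithLp.toLp 2 (-C x, S x)) ∈
        (blockOp S C).graph := mem_graph_blockOp_iff.2
      ⟨S.mem_graph x, by simp⟩
    have h1 := h _ _ hg
    rw [WithLp.prod_inner_apply] at h1
    change ⟪w.fst, -C x - (ε : ℂ) • (x : Y)⟫_ℂ + ⟪w.snd, S x - (ε : ℂ) • (0 : Y)⟫_ℂ = 0 at h1
    rw [smul_zero, sub_zero, inner_sub_right, inner_neg_right, inner_smul_right] at h1
    rw [inner_add_left, ContinuousLinearMap.adjoint_inner_left, inner_smul_left,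
      Complex.conj_ofReal]
    linear_combination -h1

/-- Dissipativity bounds the graph norm by the image, so the range is closed. A vector orthogonal to
it satisfies the adjoint equations, and pairing these gives ε‖w‖² ≤ 0. -/
theorem exists_graph_blockOp_sub_smul_eq (hS : IsPosSelfAdjoint S) (hC : HasSectorBound C k)
    {ε : ℝ} (hε : 0 < ε) (f : WithLp 2 (Y × Y)) :
    ∃ z w, (z, w) ∈ (blockOp S C).graph ∧ w - (ε : ℂ) • z = f := by
  let P := (blockOp S C).graph
  let g : P →L[ℂ] WithLp 2 (Y × Y) :=
    (ContinuousLinearMap.snd ℂ (WithLp 2 (Y × Y)) (WithLp 2 (Y × Y)) -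
      (ε : ℂ) • ContinuousLinearMap.fst ℂ (WithLp 2 (Y × Y)) (WithLp 2 (Y × Y))).comp P.subtypeL
  have hg : ∀ p : P, g p = p.1.2 - (ε : ℂ) • p.1.1 := fun p => rfl
  have hle : ∀ p : P, ‖p‖ ≤ (2 + ε⁻¹) * ‖g p‖ := by
    intro p
    have h1 : ‖p.1.2‖ ^ 2 + (ε * ‖p.1.1‖) ^ 2 ≤ ‖g p‖ ^ 2 := by
      have h2 := norm_sub_sq (𝕜 := ℂ) p.1.2 ((ε : ℂ) • p.1.1)
      have h3 := re_inner_graph_blockOp hS (z := p.1.1) (w := p.1.2) p.2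
      have h4 := (hC p.1.1.fst).1
      rw [inner_smul_right, norm_smul, Complex.norm_real, Real.norm_of_nonneg hε.le] at h2
      change _ = _ - 2 * ((ε : ℂ) * ⟪p.1.2, p.1.1⟫_ℂ).re + _ at h2
      rw [Complex.re_ofReal_mul, h3] at h2
      rw [hg, h2]
      nlinarith [mul_nonneg hε.le h4]
    have h5 : ‖p.1.2‖ ≤ ‖g p‖ :=
      le_of_sq_le_sq (by nlinarith [sq_nonneg (ε * ‖p.1.1‖)]) (norm_nonneg _)
    have h6 : ε * ‖p.1.1‖ ≤ ‖g p‖ :=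
      le_of_sq_le_sq (by nlinarith [sq_nonneg ‖p.1.2‖]) (norm_nonneg _)
    have h7 : ‖p.1.1‖ ≤ ε⁻¹ * ‖g p‖ := by
      rwa [inv_mul_eq_div, le_div_iff₀ hε, mul_comm]
    have h8 := norm_nonneg (g p)
    have h9 : 0 ≤ ε⁻¹ * ‖g p‖ := by positivity
    rw [Submodule.coe_norm, Prod.norm_def]
    refine max_le ?_ ?_ <;> linarith
  have hanti : AntilipschitzWith (Real.toNNReal (2 + ε⁻¹)) g :=
    AddMonoidHomClass.antilipschitz_of_bound g (by
      rw [Real.coe_toNNReal _ (by positivity)]; exact hle)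
  have : CompleteSpace P := (isClosed_graph_blockOp hS).completeSpace_coe
  have hrc : IsClosed (Set.range g) := hanti.isClosed_range g.uniformContinuous
  have htop : LinearMap.range (g : P →ₗ[ℂ] WithLp 2 (Y × Y)) = ⊤ := by
    set K := LinearMap.range (g : P →ₗ[ℂ] WithLp 2 (Y × Y)) with hK
    have hKc : IsClosed (K : Set (WithLp 2 (Y × Y))) := by
      simpa [hK, LinearMap.coe_range] using hrc
    have : CompleteSpace K := hKc.completeSpace_coe
    rw [← Submodule.orthogonal_eq_bot_iff, Submodule.eq_bot_iff]
    intro w hw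
    obtain ⟨h1, h2⟩ := mem_graph_of_orthogonal_range (C := C) hS ε (w := w) fun z v hzv =>
      (Submodule.mem_orthogonal' K w).1 hw _ ⟨⟨(z, v), hzv⟩, rfl⟩
    have h3 := congrArg Complex.re (inner_graph_symm hS h1 h2)
    rw [inner_neg_left, inner_smul_left, Complex.conj_ofReal, inner_add_right,
      ContinuousLinearMap.adjoint_inner_right, inner_smul_right, Complex.neg_re, Complex.add_re,
      Complex.re_ofReal_mul, Complex.re_ofReal_mul] at h3
    have h4 : (⟪C w.fst, w.fst⟫_ℂ).re = (⟪w.fst, C w.fst⟫_ℂ).re := inner_re_symm (𝕜 := ℂ) _ _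
    have h5 := (hC w.fst).1
    have h6 : (⟪w.fst, w.fst⟫_ℂ).re = ‖w.fst‖ ^ 2 := inner_self_eq_norm_sq (𝕜 := ℂ) _
    have h7 : (⟪w.snd, w.snd⟫_ℂ).re = ‖w.snd‖ ^ 2 := inner_self_eq_norm_sq (𝕜 := ℂ) _
    rw [h4, h6, h7] at h3
    have h8 : ε * (‖w.fst‖ ^ 2 + ‖w.snd‖ ^ 2) ≤ 0 := by linarith
    rw [← norm_eq_zero, ← sq_eq_zero_iff, WithLp.prod_norm_sq_eq_of_L2]
    have h9 : 0 ≤ ‖w.fst‖ ^ 2 + ‖w.snd‖ ^ 2 := by positivity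
    exact le_antisymm (nonpos_of_mul_nonpos_right h8 hε) h9
  obtain ⟨p, hp⟩ := LinearMap.range_eq_top.1 htop f
  exact ⟨p.1.1, p.1.2, p.2, hp⟩

attribute [local instance] InnerProductSpace.complexToReal

theorem isMDissipative_inverse_partIn_blockOp (hS : IsPosSelfAdjoint S) (hC : HasSectorBound C k)
    {X : Submodule ℂ (WithLp 2 (Y × Y))} (hX : X = (nullSpace (blockOp S C))ᗮ) :
    IsMDissipative (partIn (blockOp S C) X).inverse where
  inner_nonpos {x y} h := by
    have h1 := re_inner_graph_blockOp hS ((mem_graph_inverse_partIn_iff hX).1 h)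
    change (⟪(x : WithLp 2 (Y × Y)), (y : WithLp 2 (Y × Y))⟫_ℂ).re ≤ 0
    rw [h1]
    exact neg_nonpos.2 (hC _).1
  exists_sub_smul_eq ε hε f := by
    obtain ⟨z, w, hzw, e⟩ := exists_graph_blockOp_sub_smul_eq hS hC hε (f : WithLp 2 (Y × Y))
    have hw : w ∈ X := hX ▸ mem_orthogonal_nullSpace_of_graph hS hC hzw
    have hz : z ∈ X := by
      have h1 : (ε : ℂ) • z ∈ X := by
        have : (ε : ℂ) • z = w - f := by rw [← e]; abel
        rw [this]
        exact X.sub_mem hw f.2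
      exact (X.smul_mem_iff (Complex.ofReal_ne_zero.2 hε.ne')).1 h1
    exact ⟨⟨w, hw⟩, ⟨z, hz⟩, (mem_graph_inverse_partIn_iff hX).2 hzw, Subtype.ext e⟩
  dense_domain := by
    set A := (partIn (blockOp S C) X).inverse with hA
    have hdom : {x | ∃ y, (x, y) ∈ A.graph} = (A.domain : Set X) := by
      ext x
      exact LinearPMap.mem_domain_iff.symm
    have hXc : CompleteSpace X := by subst hX; infer_instance
    have hNc : CompleteSpace (nullSpace (blockOp S C)) :=
      (isClosed_nullSpace_blockOp hS).completeSpace_coe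
    rw [hdom, Submodule.dense_iff_topologicalClosure_eq_top,
      Submodule.topologicalClosure_eq_top_iff, Submodule.eq_bot_iff]
    intro w hw
    have hwX : (w : WithLp 2 (Y × Y)) ∈ (nullSpace (blockOp S C))ᗮ := hX ▸ w.2
    -- The domain of the inverse is the whole range of 𝒜⁺, since null components can be subtracted.
    -- A vector orthogonal to it solves the adjoint equations with ε = 0, and accretivity then
    -- places it in the null-space.
    obtain ⟨h1, h2⟩ := mem_graph_of_orthogonal_range (C := C) hS 0
      (w := (w : WithLp 2 (Y × Y))) fun z v hzv => by
        obtain ⟨n, hn, x, hx, rfl⟩ :=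
          (nullSpace (blockOp S C)).exists_add_mem_mem_orthogonal z
        have hv : v ∈ X := hX ▸ mem_orthogonal_nullSpace_of_graph hS hC hzv
        have hxv : (x, v) ∈ (blockOp S C).graph := by
          simpa using (blockOp S C).graph.sub_mem hzv (mem_nullSpace_iff.1 hn)
        have hmem : (⟨v, hv⟩ : X) ∈ A.domain := LinearPMap.mem_domain_iff.2
          ⟨⟨x, hX ▸ hx⟩, (mem_graph_inverse_partIn_iff hX).2 hxv⟩
        have := (Submodule.mem_orthogonal' _ w).1 hw _ hmem
        rw [Complex.ofReal_zero, zero_smul, sub_zero]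
        exact this
    rw [Complex.ofReal_zero, zero_smul, neg_zero] at h1
    rw [Complex.ofReal_zero, zero_smul, add_zero] at h2
    have h3 := inner_graph_symm hS h1 h2
    rw [inner_zero_left, ContinuousLinearMap.adjoint_inner_right] at h3
    have h4 : (⟪(w : WithLp 2 (Y × Y)).fst, C (w : WithLp 2 (Y × Y)).fst⟫_ℂ).re = 0 := by
      rw [← inner_conj_symm, ← h3]; simp
    have h5 : ContinuousLinearMap.adjoint C (w : WithLp 2 (Y × Y)).fst = 0 := by
      refine ext_inner_right ℂ fun y => ?_
      rw [ContinuousLinearMap.adjoint_inner_left, (hC.eq_zero h4).2, inner_zero_left]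
    rw [h5] at h2
    have h6 := Submodule.inner_right_of_mem_orthogonal
      ((mem_nullSpace_blockOp_iff hS hC).2 ⟨h1, h4, h2⟩) hwX
    exact Subtype.ext (inner_self_eq_zero.1 h6)

theorem generatesExpStable_of_re_eq (hS : IsPosSelfAdjoint S) {C₁ C₂ : Y →L[ℂ] Y} {k₁ k₂ : ℝ}
    (h₁ : HasSectorBound C₁ k₁) (h₂ : HasSectorBound C₂ k₂)
    (he : ∀ y, (⟪y, C₁ y⟫_ℂ).re = (⟪y, C₂ y⟫_ℂ).re) {X : Submodule ℂ (WithLp 2 (Y × Y))}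
    (hX : X = (nullSpace (blockOp S C₁))ᗮ)
    (hs : GeneratesExpStable (partIn (blockOp S C₁) X).inverse) :
    GeneratesExpStable (partIn (blockOp S C₂) X).inverse := by
  have hX' : X = (nullSpace (blockOp S C₂))ᗮ := by rw [hX, nullSpace_blockOp_congr hS h₁ h₂ he]
  obtain ⟨k, hk, hb⟩ := h₁.exists_re_inner_sub_le h₂ he
  have hXc : CompleteSpace X := by subst hX; infer_instance
  -- The correction stays in 𝒳: the first component of a null vector is annihilated by the adjoints
  -- of both dampings.
  have hE : ∀ y : Y, WithLp.toLp 2 ((C₂ - C₁) y, (0 : Y)) ∈ X := fun y => by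
    rw [hX, Submodule.mem_orthogonal]
    intro n hn
    have hn' := hn
    rw [nullSpace_blockOp_congr hS h₁ h₂ he] at hn'
    have e1 := (h₁.eq_zero ((mem_nullSpace_blockOp_iff hS h₁).1 hn).2.1).2 y
    have e2 := (h₂.eq_zero ((mem_nullSpace_blockOp_iff hS h₂).1 hn').2.1).2 y
    rw [WithLp.prod_inner_apply]
    change ⟪n.fst, C₂ y - C₁ y⟫_ℂ + ⟪n.snd, (0 : Y)⟫_ℂ = 0
    rw [inner_sub_right, e1, e2, inner_zero_right, sub_zero, add_zero]
  refine GeneratesExpStable.of_comparison (isMDissipative_inverse_partIn_blockOp hS h₁ hX)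
    (isMDissipative_inverse_partIn_blockOp hS h₂ hX')
    (h := fun y => (⟪(y : WithLp 2 (Y × Y)).fst, C₁ (y : WithLp 2 (Y × Y)).fst⟫_ℂ).re)
    (E := fun y => ⟨_, hE (y : WithLp 2 (Y × Y)).fst⟩) hk ?_ ?_ ?_ ?_ hs
  · intro x y hxy
    obtain ⟨e1, e2⟩ := mem_graph_blockOp_iff.1 ((mem_graph_inverse_partIn_iff hX').1 hxy)
    refine (mem_graph_inverse_partIn_iff hX).2 (mem_graph_blockOp_iff.2 ⟨?_, ?_⟩)
    · change (_, (x : WithLp 2 (Y × Y)).snd + 0) ∈ _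
      rwa [add_zero]
    · change (_, -C₁ (y : WithLp 2 (Y × Y)).fst - ((x : WithLp 2 (Y × Y)).fst +
        (C₂ (y : WithLp 2 (Y × Y)).fst - C₁ (y : WithLp 2 (Y × Y)).fst))) ∈ _
      convert e2 using 2
      abel
  · intro x y hxy
    exact (re_inner_graph_blockOp hS ((mem_graph_inverse_partIn_iff hX).1 hxy)).le
  · intro x y hxy
    rw [he]
    exact (re_inner_graph_blockOp hS ((mem_graph_inverse_partIn_iff hX').1 hxy)).le
  · intro y z
    refine le_trans (le_of_eq ?_) (hb (y : WithLp 2 (Y × Y)).fst (z : WithLp 2 (Y × Y)).fst)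
    change (⟪WithLp.toLp 2 ((C₂ - C₁) (y : WithLp 2 (Y × Y)).fst, (0 : Y)),
      (z : WithLp 2 (Y × Y))⟫_ℂ).re = _
    rw [WithLp.prod_inner_apply]
    change (⟪(C₂ - C₁) (y : WithLp 2 (Y × Y)).fst, (z : WithLp 2 (Y × Y)).fst⟫_ℂ +
      ⟪(0 : Y), (z : WithLp 2 (Y × Y)).snd⟫_ℂ).re = _
    rw [inner_zero_left, add_zero]

theorem SystemExpStable.of_re_eq {M : Y →ₗ.[ℂ] Y} {hM : IsPosSelfAdjoint M} {C₁ C₂ : Y →L[ℂ] Y}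
    {k₁ k₂ : ℝ} (h₁ : HasSectorBound C₁ k₁) (h₂ : HasSectorBound C₂ k₂)
    (he : ∀ y, (⟪y, C₁ y⟫_ℂ).re = (⟪y, C₂ y⟫_ℂ).re) (hs : SystemExpStable M hM C₁) :
    SystemExpStable M hM C₂ := by
  have hS := (posSqrt_spec M hM).isPosSelfAdjoint
  have hX : physicalSpace M hM C₁ = physicalSpace M hM C₂ :=
    congrArg Submodule.orthogonal (nullSpace_blockOp_congr hS h₁ h₂ he)
  have h := generatesExpStable_of_re_eq hS h₁ h₂ he rfl hs
  change GeneratesExpStable (partIn (phaseOp M hM C₂) (physicalSpace M hM C₁)).inverse at h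
  rwa [hX] at h

end BlockOp

end DampedSystem

end

theorem theorem5 {Y : Type*} [NormedAddCommGroup Y] [InnerProductSpace ℂ Y] [CompleteSpace Y]
    (M : Y →ₗ.[ℂ] Y) (hM : DampedSystem.IsPosSelfAdjoint M)
    (C : Y →L[ℂ] Y) (hC : DampedSystem.IsSectorial C) :
    DampedSystem.SystemExpStable M hM C ↔
      DampedSystem.SystemExpStable M hM
        ((1 / 2 : ℂ) • (ContinuousLinearMap.adjoint C + C)) := by
  obtain ⟨k, hk⟩ := hC.exists_hasSectorBound
  obtain ⟨h, he⟩ := DampedSystem.hasSectorBound_hermitianPart hk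
  exact ⟨.of_re_eq hk h fun y => (he y).symm, .of_re_eq h hk he⟩
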